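/- Let $n\ge 2$, $N=\{1,\dots,n\}$, and let $N'$ be a disjoint copy of $N$. Let $P_n$ be the set of all partitions of $N\cup N'$ each of whose blocks is either a point (a one-element set) or a generalised line (a set meeting both $N$ and $N'$). Two multiplications are defined on $P_n$. * $\mathcal{PI}^{*}_n=(P_n,\star)$. Add a new point $\bar x$ to $N$, and for $\alpha\in P_n$ let $\bar\alpha$ be the partition of $(N\cup\{\bar x\})\cup(N\cup\{\bar x\})'$ whose blocks are the generalised lines of $\alpha$ and one more block consisting of $\bar x$, $\bar x'$ and all points of $\alpha$. Then $\alpha\star\beta$ is the element with $\overline{\alpha\star\beta}=\bar\alpha\,\bar\beta$, where the product on the right is the usual product of partition diagrams (identify the bottom row of the first with the top row of the second, and take the connectedness induced on the outer rows). * $\overline{\mathcal{PI}^{*}}_n=(P_n,\circ)$. The generalised lines of $\alpha\circ\beta$ are the sets $A\cup C'$ such that for some $B\subseteq N$ the set $A\cup B'$ is a generalised line of $\alpha$ and $B\cup C'$ is a generalised line of $\beta$; all other elements are points. Both are inverse semigroups, the inverse being obtained by exchanging $N$ and $N'$. Let $\mathcal I_Y$ denote the symmetric inverse semigroup of all partial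 bijections of a set $Y$ (composed from left to right), and write $\mathcal I_m$ if $Y=\{1,\dots,m\}$. A representation $\rho:S\to\mathcal I_Y$ (a semigroup homomorphism) is faithful if it is injective, effective if every $y\in Y$ is in the domain of some $\rho(s)$, and transitive if for all $y,z\in Y$ some $\rho(s)$ maps $y$ to $z$; two representations $S\to\mathcal I_Y$, $S\to\mathcal I_Z$ are equivalent if a bijection $Y\to Z$ carries one to the other. Let $\omega$ be the natural partial order of an inverse semigroup $S$ ($a\le b$ iff $a=eb$ for some idempotent $e$), and $A\omega$ the set of elements lying above some element of $A$. For a closed inverse subsemigroup $H$ of $S$ (a nonempty subset closed under products and inverses with $H\omega=H$) let $\mathcal C_H=\{(Hs)\omega: ss^{-1}\in H\}$, and let $\phi_H:S\to\mathcal I_{\mathcal C_H}$ be the representation $$\phi_H(s)=\{((Hx)\omega,(Hxs)\omega):(Hx)\omega,(Hxs)\omega\in\mathcal C_H\}.$$ An idempotent is primitive if it is minimal among the nonzero idempotents. **Theorem.** Let $S$ be $\mathcal{PI}^{*}_n$ or $\overline{\mathcal{PI}^{*}}_n$, with $n\ge2$. Up to equivalence, $S$ has exactly one faithful effective transitive representation,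 and it is a representation $\rho:S\to\mathcal I_{2^n-1}$. In particular $S$ embeds into $\mathcal I_{2^n-1}$. More precisely, $S$ has primitive idempotents, and: 1. there is a faithful effective transitive representation $\rho:S\to\mathcal I_{2^n-1}$, and $\phi_{e\omega}$ is equivalent to $\rho$ for every primitive idempotent $e$ of $S$; 2. for a closed inverse subsemigroup $H$ of $S$, the representation $\phi_H$ is faithful if and only if $H=e\omega$ for some primitive idempotent $e$; and if $\phi_H$ and $\phi_K$ are both faithful, then there is $a\in S$ with $a^{-1}Ha\subseteq K$ and $aKa^{-1}\subseteq H$; 3. every faithful effective transitive representation $\sigma:S\to\mathcal I_Y$, for any set $Y$, is equivalent to $\rho$. -/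

import Mathlib

/-! ## Inverse semigroups and the natural partial order -/

/-- An inverse semigroup: every `a` has a unique inverse, denoted `a⁻¹`. -/
class InverseSemigroup (S : Type*) extends Semigroup S, Inv S where
  mul_inv_mul : ∀ a : S, a * a⁻¹ * a = a
  inv_mul_inv : ∀ a : S, a⁻¹ * a * a⁻¹ = a⁻¹
  inv_unique : ∀ a b : S, a * b * a = a → b * a * b = b → b = a⁻¹

/-- The natural partial order of an inverse semigroup: `a ≤ b` iff `a = e * b` for some
idempotent `e`. -/
def NatLE {S : Type*} [InverseSemigroup S] (a b : S) : Prop :=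
  ∃ e : S, e * e = e ∧ a = e * b

/-- `z` is a zero of the semigroup. -/
def IsZeroElt {S : Type*} [Mul S] (z : S) : Prop := ∀ s : S, z * s = z ∧ s * z = z

/-- A primitive idempotent: a nonzero idempotent below which, in the natural partial order,
the only idempotents are itself and (possibly) zero. -/
def IsPrimitiveIdem {S : Type*} [InverseSemigroup S] (e : S) : Prop :=
  e * e = e ∧ ¬ IsZeroElt e ∧ ∀ f : S, f * f = f → NatLE f e → IsZeroElt f ∨ f = e

namespace InverseSemigroup

variable {S : Type*} [InverseSemigroup S]

theorem inv_of_idem {e : S} (he : e * e = e) : e⁻¹ = e :=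
  (inv_unique e e (by rw [he, he]) (by rw [he, he])).symm

theorem idem_comm {e f : S} (he : e * e = e) (hf : f * f = f) : e * f = f * e := by
  have key : ∀ {e f : S}, e * e = e → f * f = f → (e * f) * (e * f) = e * f := by
    intro e f he hf
    have he' : ∀ t, e * (e * t) = e * t := fun t => by rw [← mul_assoc, he]
    have hf' : ∀ t, f * (f * t) = f * t := fun t => by rw [← mul_assoc, hf]
    have h1 := mul_inv_mul (e * f)
    have h2 := inv_mul_inv (e * f)
    set x := (e * f)⁻¹ with hx
    simp only [mul_assoc] at h1 h2
    have h2' : ∀ t, x * (e * (f * (x * t))) = x * t := fun t => by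
      conv_rhs => rw [← h2]
      simp only [mul_assoc]
    have h3 : f * x * e = x := by
      rw [hx]
      apply inv_unique
      · rw [← hx]
        simp only [mul_assoc, he', hf']
        exact h1
      · rw [← hx]
        simp only [mul_assoc, he', hf', h2']
    have hxx : x * x = x := by
      rw [← h3]
      simp only [mul_assoc, h2']
    have h4 : e * f = x := by
      have := inv_unique x (e * f)
        (by simp only [mul_assoc]; exact h2) (by simp only [mul_assoc]; exact h1)
      rw [this, inv_of_idem hxx]
    rw [h4, hxx]
  have hef := key he hf
  have hfe := key hf he
  have he' : ∀ t, e * (e * t) = e * t := fun t => by rw [← mul_assoc, he]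
  have hf' : ∀ t, f * (f * t) = f * t := fun t => by rw [← mul_assoc, hf]
  have h1 : f * e = (e * f)⁻¹ := by
    apply inv_unique
    · simp only [mul_assoc] at hef ⊢
      simp only [he', hf', hef]
    · simp only [mul_assoc] at hfe ⊢
      simp only [he', hf', hfe]
  rw [h1, inv_of_idem hef]

theorem mul_inv_idem (a : S) : (a * a⁻¹) * (a * a⁻¹) = a * a⁻¹ := by
  rw [← mul_assoc, mul_inv_mul]

theorem inv_mul_idem (a : S) : (a⁻¹ * a) * (a⁻¹ * a) = a⁻¹ * a := by
  rw [← mul_assoc, inv_mul_inv]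

theorem idem_mul {e f : S} (he : e * e = e) (hf : f * f = f) :
    (e * f) * (e * f) = e * f := by
  rw [mul_assoc, ← mul_assoc f e f, ← idem_comm he hf, mul_assoc e f f, hf, ← mul_assoc, he]

theorem conj_idem {e : S} (he : e * e = e) (c : S) :
    (c * e * c⁻¹) * (c * e * c⁻¹) = c * e * c⁻¹ := by
  calc (c * e * c⁻¹) * (c * e * c⁻¹) = c * (e * (c⁻¹ * c)) * e * c⁻¹ := by simp only [mul_assoc]
    _ = c * ((c⁻¹ * c) * e) * e * c⁻¹ := by rw [idem_comm he (inv_mul_idem c)]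
    _ = (c * c⁻¹ * c) * (e * e) * c⁻¹ := by simp only [mul_assoc]
    _ = c * e * c⁻¹ := by rw [mul_inv_mul, he]

theorem mul_inv (a b : S) : (a * b)⁻¹ = b⁻¹ * a⁻¹ := by
  symm
  apply inv_unique
  · calc a * b * (b⁻¹ * a⁻¹) * (a * b) = a * ((b * b⁻¹) * (a⁻¹ * a)) * b := by
          simp only [mul_assoc]
      _ = a * ((a⁻¹ * a) * (b * b⁻¹)) * b := by
          rw [idem_comm (mul_inv_idem b) (inv_mul_idem a)]
      _ = (a * a⁻¹ * a) * (b * b⁻¹ * b) := by simp only [mul_assoc]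
      _ = a * b := by rw [mul_inv_mul, mul_inv_mul]
  · calc b⁻¹ * a⁻¹ * (a * b) * (b⁻¹ * a⁻¹) = b⁻¹ * ((a⁻¹ * a) * (b * b⁻¹)) * a⁻¹ := by
          simp only [mul_assoc]
      _ = b⁻¹ * ((b * b⁻¹) * (a⁻¹ * a)) * a⁻¹ := by
          rw [idem_comm (mul_inv_idem b) (inv_mul_idem a)]
      _ = (b⁻¹ * b * b⁻¹) * (a⁻¹ * a * a⁻¹) := by simp only [mul_assoc]
      _ = b⁻¹ * a⁻¹ := by rw [inv_mul_inv, inv_mul_inv]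

theorem inv_inv (a : S) : (a⁻¹)⁻¹ = a :=
  (inv_unique _ _ (inv_mul_inv a) (mul_inv_mul a)).symm

theorem le_refl (a : S) : NatLE a a := ⟨a * a⁻¹, mul_inv_idem a, (mul_inv_mul a).symm⟩

theorem le_trans {a b c : S} : NatLE a b → NatLE b c → NatLE a c := by
  rintro ⟨e, he, rfl⟩ ⟨f, hf, rfl⟩
  exact ⟨e * f, idem_mul he hf, (mul_assoc _ _ _).symm⟩

theorem idem_mul_le {e : S} (he : e * e = e) (a : S) : NatLE (e * a) a := ⟨e, he, rfl⟩

theorem mul_le_right {a b : S} (h : NatLE a b) (c : S) : NatLE (a * c) (b * c) := by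
  obtain ⟨e, he, rfl⟩ := h
  exact ⟨e, he, mul_assoc _ _ _⟩

theorem mul_le_left {a b : S} (h : NatLE a b) (c : S) : NatLE (c * a) (c * b) := by
  obtain ⟨e, he, rfl⟩ := h
  refine ⟨c * e * c⁻¹, conj_idem he c, ?_⟩
  calc c * (e * b) = (c * c⁻¹ * c) * e * b := by rw [mul_inv_mul, mul_assoc]
    _ = c * ((c⁻¹ * c) * e) * b := by simp only [mul_assoc]
    _ = c * (e * (c⁻¹ * c)) * b := by rw [idem_comm he (inv_mul_idem c)]
    _ = c * e * c⁻¹ * (c * b) := by simp only [mul_assoc]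

theorem mul_le_mul {a b c d : S} (h : NatLE a b) (h' : NatLE c d) : NatLE (a * c) (b * d) :=
  le_trans (mul_le_right h c) (mul_le_left h' b)

theorem inv_le_inv {a b : S} (h : NatLE a b) : NatLE a⁻¹ b⁻¹ := by
  obtain ⟨e, he, rfl⟩ := h
  refine ⟨b⁻¹ * e * (b⁻¹)⁻¹, conj_idem he _, ?_⟩
  rw [mul_inv, inv_of_idem he, inv_inv]
  calc b⁻¹ * e = (b⁻¹ * b * b⁻¹) * e := by rw [inv_mul_inv]
    _ = b⁻¹ * ((b * b⁻¹) * e) := by simp only [mul_assoc]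
    _ = b⁻¹ * (e * (b * b⁻¹)) := by rw [idem_comm he (mul_inv_idem b)]
    _ = b⁻¹ * e * b * b⁻¹ := by simp only [mul_assoc]

theorem mul_idem_le {e : S} (he : e * e = e) (a : S) : NatLE (a * e) a := by
  have := inv_le_inv (idem_mul_le he a⁻¹)
  rwa [mul_inv, inv_of_idem he, inv_inv] at this

/-- A multiplication and an inversion represented faithfully by partial bijections
(given as relations) form an inverse semigroup. -/
@[reducible] def ofRel {S P : Type*} [Mul S] [Inv S] (f : S → P → P → Prop)
    (hinj : Function.Injective f)
    (hfun : ∀ a p q q', f a p q → f a p q' → q = q')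
    (hinv : ∀ a p q, f a⁻¹ p q ↔ f a q p)
    (hmul : ∀ a b p r, f (a * b) p r ↔ ∃ q, f a p q ∧ f b q r) : InverseSemigroup S where
  mul_assoc a b c := by
    apply hinj
    funext p r
    simp only [hmul, eq_iff_iff]
    constructor
    · rintro ⟨q, ⟨t, h1, h2⟩, h3⟩
      exact ⟨t, h1, q, h2, h3⟩
    · rintro ⟨t, h1, q, h2, h3⟩
      exact ⟨q, ⟨t, h1, h2⟩, h3⟩
  mul_inv_mul a := by
    apply hinj
    funext p r
    simp only [hmul, hinv, eq_iff_iff]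
    constructor
    · rintro ⟨q, ⟨t, h1, h2⟩, h3⟩
      have := hfun a⁻¹ t p q ((hinv _ _ _).2 h1) ((hinv _ _ _).2 h2)
      exact this ▸ h3
    · intro h
      exact ⟨p, ⟨r, h, h⟩, h⟩
  inv_mul_inv a := by
    apply hinj
    funext p r
    simp only [hmul, hinv, eq_iff_iff]
    constructor
    · rintro ⟨q, ⟨t, h1, h2⟩, h3⟩
      have := hfun a t p q h1 h2
      exact this ▸ h3
    · intro h
      exact ⟨p, ⟨r, h, h⟩, h⟩
  inv_unique a b h1 h2 := by
    have hinj' : ∀ a p p' q, f a p q → f a p' q → p = p' := fun a p p' q h h' =>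
      hfun a⁻¹ q p p' ((hinv _ _ _).2 h) ((hinv _ _ _).2 h')
    have key : ∀ a b : S, a * b * a = a → ∀ p q, f a p q → f b q p := by
      intro a b h p q hpq
      have h' := hpq
      rw [← h] at h'
      obtain ⟨v, hv, hvq⟩ := (hmul _ _ _ _).1 h'
      obtain ⟨u, hu, huv⟩ := (hmul _ _ _ _).1 hv
      have e1 := hfun _ _ _ _ hpq hu
      have e2 := hinj' _ _ _ _ hpq hvq
      rw [e1]
      rw [e2] at hpq ⊢
      exact huv
    apply hinj
    funext p q
    rw [hinv, eq_iff_iff]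
    exact ⟨key b a h2 p q, key a b h1 q p⟩

end InverseSemigroup

/-! ## The symmetric inverse semigroup and representations -/

/-- The symmetric inverse semigroup `I_Y` of all partial bijections of `Y`, with
composition from left to right. -/
def SymInv (Y : Type*) : Type _ := Y ≃. Y

namespace SymInv

/-- `f.Maps x y`: the partial bijection `f` is defined at `x` and sends `x` to `y`. -/
def Maps {Y : Type*} (f : SymInv Y) (x y : Y) : Prop := y ∈ (show Y ≃. Y from f) x

instance (Y : Type*) : Mul (SymInv Y) := ⟨fun f g => PEquiv.trans f g⟩

theorem maps_mul {Y : Type*} (f g : SymInv Y) (x z : Y) :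
    (f * g).Maps x z ↔ ∃ y, f.Maps x y ∧ g.Maps y z := PEquiv.mem_trans _ _ _ _

theorem ext {Y : Type*} {f g : SymInv Y} (h : ∀ x y, f.Maps x y ↔ g.Maps x y) : f = g :=
  PEquiv.ext fun x => Option.ext fun y => h x y

open Classical in
/-- The partial bijection whose graph is the relation `R`. -/
noncomputable def ofRel {Y : Type*} (R : Y → Y → Prop)
    (h1 : ∀ x y y', R x y → R x y' → y = y') (h2 : ∀ x x' y, R x y → R x' y → x = x') :
    SymInv Y where
  toFun x := if h : ∃ y, R x y then some h.choose else none
  invFun y := if h : ∃ x, R x y then some h.choose else none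
  inv x y := by
    constructor
    · intro h
      split_ifs at h with hx
      · simp only [Option.some.injEq] at h
        have h3 : R x y := by rw [← h]; exact hx.choose_spec
        rw [dif_pos ⟨y, h3⟩]
        exact congrArg some (h1 _ _ _ (Exists.choose_spec (⟨y, h3⟩ : ∃ y, R x y)) h3)
    · intro h
      split_ifs at h with hx
      · simp only [Option.some.injEq] at h
        have h3 : R x y := by rw [← h]; exact hx.choose_spec
        rw [dif_pos ⟨x, h3⟩]
        exact congrArg some (h2 _ _ _ (Exists.choose_spec (⟨x, h3⟩ : ∃ x, R x y)) h3)

theorem maps_ofRel {Y : Type*} (R : Y → Y → Prop)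
    (h1 : ∀ x y y', R x y → R x y' → y = y') (h2 : ∀ x x' y, R x y → R x' y → x = x')
    (x y : Y) : (ofRel R h1 h2).Maps x y ↔ R x y := by
  classical
  change y ∈ (if h : ∃ y, R x y then some h.choose else none) ↔ R x y
  constructor
  · intro h
    split_ifs at h with hx
    · simp only [Option.mem_def, Option.some.injEq] at h
      rw [← h]; exact hx.choose_spec
    · simp at h
  · intro h3
    rw [dif_pos ⟨y, h3⟩]
    exact congrArg some (h1 _ _ _ (Exists.choose_spec (⟨y, h3⟩ : ∃ y, R x y)) h3)

end SymInv

/-- A representation `ρ : S → I_Y` is effective if every point of `Y` lies in the domain of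
some `ρ s`. -/
def IsEffectiveRep {S Y : Type*} [Mul S] (ρ : S →ₙ* SymInv Y) : Prop :=
  ∀ y, ∃ s z, (ρ s).Maps y z

/-- A representation `ρ : S → I_Y` is transitive if any point of `Y` is sent to any other
by some `ρ s`. -/
def IsTransitiveRep {S Y : Type*} [Mul S] (ρ : S →ₙ* SymInv Y) : Prop :=
  ∀ y z, ∃ s, (ρ s).Maps y z

/-- A representation is faithful if it is injective. -/
def IsFaithfulRep {S Y : Type*} [Mul S] (ρ : S →ₙ* SymInv Y) : Prop :=
  Function.Injective ρ

/-- Two representations are equivalent if a bijection of the underlying sets carries one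
to the other. -/
def EquivalentRep {S Y Z : Type*} [Mul S] (ρ : S →ₙ* SymInv Y) (σ : S →ₙ* SymInv Z) : Prop :=
  ∃ θ : Y ≃ Z, ∀ s y y', (ρ s).Maps y y' ↔ (σ s).Maps (θ y) (θ y')

/-! ## Closed inverse subsemigroups and the representations on cosets -/

/-- A closed inverse subsemigroup: a nonempty subset closed under products, inverses and
going up in the natural partial order. -/
@[ext] structure ClosedInvSubsemigroup (S : Type*) [InverseSemigroup S] where
  carrier : Set S
  nonempty' : carrier.Nonempty
  mul_mem' : ∀ {a b}, a ∈ carrier → b ∈ carrier → a * b ∈ carrier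
  inv_mem' : ∀ {a}, a ∈ carrier → a⁻¹ ∈ carrier
  up_mem' : ∀ {a b}, a ∈ carrier → NatLE a b → b ∈ carrier

namespace ClosedInvSubsemigroup

variable {S : Type*} [InverseSemigroup S]

open InverseSemigroup

/-- The closed inverse subsemigroup of all elements above an idempotent `e`. -/
def above (e : S) (he : e * e = e) : ClosedInvSubsemigroup S where
  carrier := {s | NatLE e s}
  nonempty' := ⟨e, InverseSemigroup.le_refl e⟩
  mul_mem' ha hb := by
    have := InverseSemigroup.mul_le_mul ha hb
    rwa [he] at this
  inv_mem' ha := by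
    have := inv_le_inv ha
    rwa [inv_of_idem he] at this
  up_mem' ha hab := InverseSemigroup.le_trans ha hab

/-- The closure, under going up in the natural partial order, of the set `H s`. -/
def cosetSet (H : ClosedInvSubsemigroup S) (s : S) : Set S :=
  {t | ∃ h ∈ H.carrier, NatLE (h * s) t}

/-- The set of right cosets of `H`: the closures of `H s` with `s * s⁻¹ ∈ H`. -/
def Cosets (H : ClosedInvSubsemigroup S) : Type _ :=
  {A : Set S // ∃ s, s * s⁻¹ ∈ H.carrier ∧ A = H.cosetSet s}

/-- The relation sending the coset of `x` to the coset of `x * s`, whenever both are in the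
set of cosets. -/
def cosetRel (H : ClosedInvSubsemigroup S) (s : S) (A B : H.Cosets) : Prop :=
  ∃ x, A.1 = H.cosetSet x ∧ B.1 = H.cosetSet (x * s)

theorem exists_idem_mem (H : ClosedInvSubsemigroup S) : ∃ e ∈ H.carrier, e * e = e := by
  obtain ⟨a, ha⟩ := H.nonempty'
  exact ⟨a * a⁻¹, H.mul_mem' ha (H.inv_mem' ha), mul_inv_idem a⟩

theorem self_mem_cosetSet (H : ClosedInvSubsemigroup S) (x : S) : x ∈ H.cosetSet x := by
  obtain ⟨e, he, hee⟩ := H.exists_idem_mem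
  exact ⟨e, he, idem_mul_le hee x⟩

theorem cosetSet_subset (H : ClosedInvSubsemigroup S) {x y : S} (h : x ∈ H.cosetSet y) :
    H.cosetSet x ⊆ H.cosetSet y := by
  obtain ⟨k, hk, hky⟩ := h
  rintro t ⟨l, hl, hlt⟩
  refine ⟨l * k, H.mul_mem' hl hk, InverseSemigroup.le_trans ?_ hlt⟩
  rw [mul_assoc]
  exact mul_le_left hky l

theorem cosetSet_mul_subset (H : ClosedInvSubsemigroup S) {x y : S}
    (h : H.cosetSet x = H.cosetSet y) (s : S) :
    H.cosetSet (x * s) ⊆ H.cosetSet (y * s) := by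
  have hx := H.self_mem_cosetSet x
  rw [h] at hx
  obtain ⟨k, hk, hky⟩ := hx
  apply H.cosetSet_subset
  exact ⟨k, hk, by rw [← mul_assoc]; exact mul_le_right hky s⟩

theorem cosetSet_mul_congr (H : ClosedInvSubsemigroup S) {x y : S}
    (h : H.cosetSet x = H.cosetSet y) (s : S) :
    H.cosetSet (x * s) = H.cosetSet (y * s) :=
  (H.cosetSet_mul_subset h s).antisymm (H.cosetSet_mul_subset h.symm s)

theorem mem_of_cosetSet_eq (H : ClosedInvSubsemigroup S) {x y : S}
    (hy : y * y⁻¹ ∈ H.carrier) (h : H.cosetSet x = H.cosetSet y) : x * x⁻¹ ∈ H.carrier := by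
  have hx := H.self_mem_cosetSet x
  rw [h] at hx
  obtain ⟨k, hk, hky⟩ := hx
  refine H.up_mem' ?_ (InverseSemigroup.mul_le_mul hky (inv_le_inv hky))
  have : k * y * (k * y)⁻¹ = k * (y * y⁻¹) * k⁻¹ := by
    rw [InverseSemigroup.mul_inv]; simp only [mul_assoc]
  rw [this]
  exact H.mul_mem' (H.mul_mem' hk hy) (H.inv_mem' hk)

theorem mem_of_coset (H : ClosedInvSubsemigroup S) {x : S} (A : H.Cosets)
    (h : A.1 = H.cosetSet x) : x * x⁻¹ ∈ H.carrier := by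
  obtain ⟨y, hy, hA⟩ := A.2
  exact H.mem_of_cosetSet_eq hy (h.symm.trans hA)

theorem cosetSet_cancel_subset (H : ClosedInvSubsemigroup S) {x y s : S}
    (hy : y * s * (y * s)⁻¹ ∈ H.carrier)
    (h : H.cosetSet (x * s) = H.cosetSet (y * s)) : H.cosetSet x ⊆ H.cosetSet y := by
  have hx := H.self_mem_cosetSet (x * s)
  rw [h] at hx
  obtain ⟨k, hk, hky⟩ := hx
  apply H.cosetSet_subset
  refine ⟨k * (y * s * (y * s)⁻¹), H.mul_mem' hk hy, ?_⟩
  have e1 : y * s * (y * s)⁻¹ * y = y * s * s⁻¹ := by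
    calc y * s * (y * s)⁻¹ * y = y * ((s * s⁻¹) * (y⁻¹ * y)) := by
          rw [InverseSemigroup.mul_inv]; simp only [mul_assoc]
      _ = y * ((y⁻¹ * y) * (s * s⁻¹)) := by
          rw [idem_comm (mul_inv_idem s) (inv_mul_idem y)]
      _ = (y * y⁻¹ * y) * (s * s⁻¹) := by simp only [mul_assoc]
      _ = y * s * s⁻¹ := by rw [mul_inv_mul, mul_assoc]
  rw [mul_assoc, e1]
  have e2 := mul_le_right hky s⁻¹
  refine InverseSemigroup.le_trans ?_ (mul_idem_le (mul_inv_idem s) x)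
  simpa only [mul_assoc] using e2

theorem cosetRel_right_unique (H : ClosedInvSubsemigroup S) (s : S) (A B B' : H.Cosets) :
    H.cosetRel s A B → H.cosetRel s A B' → B = B' := by
  rintro ⟨x, hA, hB⟩ ⟨y, hA', hB'⟩
  apply Subtype.ext
  rw [hB, hB']
  exact H.cosetSet_mul_congr (hA.symm.trans hA') s

theorem cosetRel_left_unique (H : ClosedInvSubsemigroup S) (s : S) (A A' B : H.Cosets) :
    H.cosetRel s A B → H.cosetRel s A' B → A = A' := by
  rintro ⟨x, hA, hB⟩ ⟨y, hA', hB'⟩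
  apply Subtype.ext
  rw [hA, hA']
  have h := hB.symm.trans hB'
  exact (H.cosetSet_cancel_subset (H.mem_of_coset B hB') h).antisymm
    (H.cosetSet_cancel_subset (H.mem_of_coset B hB) h.symm)

/-- The representation of `S` on the right cosets of `H`: the graph of the partial bijection
assigned to `s` is `H.cosetRel s`. -/
noncomputable def cosetRep (H : ClosedInvSubsemigroup S) : S →ₙ* SymInv H.Cosets where
  toFun s := SymInv.ofRel (H.cosetRel s) (H.cosetRel_right_unique s) (H.cosetRel_left_unique s)
  map_mul' s t := by
    apply SymInv.ext
    intro A C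
    rw [SymInv.maps_mul]
    simp only [SymInv.maps_ofRel]
    constructor
    · rintro ⟨x, hA, hC⟩
      have hm := H.mem_of_coset C hC
      have hm' : x * s * (x * s)⁻¹ ∈ H.carrier := by
        refine H.up_mem' hm ?_
        have : x * (s * t) * (x * (s * t))⁻¹ = x * s * (t * t⁻¹) * (x * s)⁻¹ := by
          rw [← mul_assoc x s t, InverseSemigroup.mul_inv (x * s) t]; simp only [mul_assoc]
        rw [this]
        exact mul_le_right (mul_idem_le (mul_inv_idem t) _) _
      exact ⟨⟨H.cosetSet (x * s), x * s, hm', rfl⟩, ⟨x, hA, rfl⟩, ⟨x * s, rfl, by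
        rw [hC, mul_assoc]⟩⟩
    · rintro ⟨B, ⟨x, hA, hB⟩, ⟨y, hB', hC⟩⟩
      refine ⟨x, hA, ?_⟩
      rw [hC, ← mul_assoc]
      exact H.cosetSet_mul_congr (hB'.symm.trans hB) t

theorem cosetRep_maps (H : ClosedInvSubsemigroup S) (s : S) (A B : H.Cosets) :
    (H.cosetRep s).Maps A B ↔ H.cosetRel s A B :=
  SymInv.maps_ofRel _ (H.cosetRel_right_unique s) (H.cosetRel_left_unique s) A B

/-- The conjugacy criterion for equivalence of the representations on the cosets of `H`
and of `K`: some `a` satisfies `a⁻¹ H a ⊆ K` and `a K a⁻¹ ⊆ H`. -/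
def Conjugate (H K : ClosedInvSubsemigroup S) : Prop :=
  ∃ a : S, (∀ h ∈ H.carrier, a⁻¹ * h * a ∈ K.carrier) ∧
    (∀ k ∈ K.carrier, a * k * a⁻¹ ∈ H.carrier)

end ClosedInvSubsemigroup

/-! ## Partitions of `X ∪ X'` -/

/-- For partitions `α`, `β` of `X ∪ X'` (top copy `Sum.inl`, bottom copy `Sum.inr`), the
connectedness relation of the three-row diagram `X ⊕ (X ⊕ X)` in which the bottom row of `α`
is identified with the top row of `β`. -/
def glue {X : Type*} (α β : Setoid (X ⊕ X)) : Setoid (X ⊕ (X ⊕ X)) :=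
  Relation.EqvGen.setoid fun p q =>
    Relation.Map α (Sum.map id Sum.inl) (Sum.map id Sum.inl) p q ∨
      Relation.Map β Sum.inr Sum.inr p q

/-- The natural multiplication of partitions of `X ∪ X'`: connectedness in the three-row
diagram, restricted to the two outer rows. -/
def natMul {X : Type*} (α β : Setoid (X ⊕ X)) : Setoid (X ⊕ X) :=
  (glue α β).comap (Sum.map id Sum.inr)

/-- The block of `u` is a point. -/
def IsPt {X : Type*} (α : Setoid (X ⊕ X)) (u : X ⊕ X) : Prop := ∀ v, α u v → v = u

/-- The block of `u` is a generalised line: it meets both `X` and `X'`. -/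
def IsGenLine {X : Type*} (α : Setoid (X ⊕ X)) (u : X ⊕ X) : Prop :=
  (∃ i, α u (Sum.inl i)) ∧ ∃ j, α u (Sum.inr j)

/-- The common carrier: partitions of `X ∪ X'` all of whose blocks are points or
generalised lines. -/
@[ext] structure PICarrier (X : Type*) where
  part : Setoid (X ⊕ X)
  pt_or_line : ∀ u, IsPt part u ∨ IsGenLine part u

namespace PICarrier

variable {X : Type*}

/-- The inclusion of `X ∪ X'` into `Y ∪ Y'`, where `Y` is `X` with one point `none` added. -/
def emb : X ⊕ X → Option X ⊕ Option X := Sum.map some some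

theorem emb_injective : Function.Injective (emb : X ⊕ X → Option X ⊕ Option X) :=
  Sum.map_injective.2 ⟨Option.some_injective X, Option.some_injective X⟩

/-- `w` lies on a generalised line of `α`. -/
def OnLine (α : PICarrier X) (w : Option X ⊕ Option X) : Prop :=
  ∃ u, w = emb u ∧ IsGenLine α.part u

/-- The partition `ᾱ` of `Y ∪ Y'`, `Y = Option X`: its blocks are the generalised lines of `α`
together with one more block, consisting of the two new points and all points of `α`. -/
def bar (α : PICarrier X) : Setoid (Option X ⊕ Option X) where
  r w z := (∃ u v, w = emb u ∧ z = emb v ∧ IsGenLine α.part u ∧ α.part u v) ∨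
    (¬ α.OnLine w ∧ ¬ α.OnLine z)
  iseqv := by
    have hl : ∀ {u v}, IsGenLine α.part u → α.part u v → IsGenLine α.part v := by
      rintro u v ⟨⟨i, hi⟩, j, hj⟩ h
      exact ⟨⟨i, α.part.trans' (α.part.symm' h) hi⟩, j, α.part.trans' (α.part.symm' h) hj⟩
    refine ⟨?_, ?_, ?_⟩
    · intro w
      by_cases h : α.OnLine w
      · obtain ⟨u, rfl, hu⟩ := h
        exact Or.inl ⟨u, u, rfl, rfl, hu, α.part.refl' u⟩
      · exact Or.inr ⟨h, h⟩
    · rintro w z (⟨u, v, rfl, rfl, hu, h⟩ | ⟨h1, h2⟩)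
      · exact Or.inl ⟨v, u, rfl, rfl, hl hu h, α.part.symm' h⟩
      · exact Or.inr ⟨h2, h1⟩
    · rintro w z t (⟨u, v, rfl, rfl, hu, h⟩ | ⟨h1, h2⟩) (⟨u', v', e, rfl, hu', h'⟩ | ⟨h1', h2'⟩)
      · obtain rfl := emb_injective e
        exact Or.inl ⟨u, v', rfl, rfl, hu, α.part.trans' h h'⟩
      · exact absurd ⟨v, rfl, hl hu h⟩ h1'
      · exact absurd ⟨u', e, hu'⟩ h2
      · exact Or.inr ⟨h1, h2'⟩

theorem not_onLine_inl (α : PICarrier X) : ¬ α.OnLine (Sum.inl none) := by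
  rintro ⟨u | u, h, -⟩ <;> simp [emb] at h

theorem not_onLine_inr (α : PICarrier X) : ¬ α.OnLine (Sum.inr none) := by
  rintro ⟨u | u, h, -⟩ <;> simp [emb] at h

theorem bar_none (α : PICarrier X) : α.bar (Sum.inl none) (Sum.inr none) :=
  Or.inr ⟨α.not_onLine_inl, α.not_onLine_inr⟩

theorem bar_genLine (α : PICarrier X) (w : Option X ⊕ Option X) : IsGenLine α.bar w := by
  by_cases h : α.OnLine w
  · obtain ⟨u, rfl, hu⟩ := h
    have hu' := hu
    obtain ⟨⟨i, hi⟩, j, hj⟩ := hu'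
    exact ⟨⟨some i, Or.inl ⟨u, Sum.inl i, rfl, rfl, hu, hi⟩⟩,
      some j, Or.inl ⟨u, Sum.inr j, rfl, rfl, hu, hj⟩⟩
  · exact ⟨⟨none, Or.inr ⟨h, α.not_onLine_inl⟩⟩, none, Or.inr ⟨h, α.not_onLine_inr⟩⟩

/-- The inverse of `bar`: the block of the new points is broken into points. -/
def unbar (γ : Setoid (Option X ⊕ Option X)) (h0 : γ (Sum.inl none) (Sum.inr none))
    (h : ∀ w, IsGenLine γ w) : PICarrier X where
  part :=
    { r := fun u v => u = v ∨ (γ (emb u) (emb v) ∧ ¬ γ (emb u) (Sum.inl none))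
      iseqv := by
        refine ⟨fun u => Or.inl rfl, ?_, ?_⟩
        · rintro u v (rfl | ⟨h1, h2⟩)
          · exact Or.inl rfl
          · exact Or.inr ⟨γ.symm' h1, fun h3 => h2 (γ.trans' h1 h3)⟩
        · rintro u v w (rfl | ⟨h1, h2⟩) (rfl | ⟨h1', h2'⟩)
          · exact Or.inl rfl
          · exact Or.inr ⟨h1', h2'⟩
          · exact Or.inr ⟨h1, h2⟩
          · exact Or.inr ⟨γ.trans' h1 h1', h2⟩ }
  pt_or_line u := by
    by_cases h1 : γ (emb u) (Sum.inl none)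
    · left
      rintro v (rfl | ⟨-, h2⟩)
      · rfl
      · exact absurd h1 h2
    · right
      obtain ⟨⟨i, hi⟩, j, hj⟩ := h (emb u)
      constructor
      · cases i with
        | none => exact absurd hi h1
        | some i => exact ⟨i, Or.inr ⟨hi, h1⟩⟩
      · cases j with
        | none => exact absurd (γ.trans' hj (γ.symm' h0)) h1
        | some j => exact ⟨j, Or.inr ⟨hj, h1⟩⟩

theorem isGenLine_unbar (γ : Setoid (Option X ⊕ Option X)) (h0 : γ (Sum.inl none) (Sum.inr none))
    (h : ∀ w, IsGenLine γ w) (u : X ⊕ X) :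
    IsGenLine (unbar γ h0 h).part u ↔ ¬ γ (emb u) (Sum.inl none) := by
  constructor
  · rintro ⟨⟨i, hi⟩, j, hj⟩ h1
    rcases hi with hi | ⟨-, hi⟩
    · rcases hj with hj | ⟨-, hj⟩
      · rw [hi] at hj; cases hj
      · exact hj h1
    · exact hi h1
  · intro h1
    obtain ⟨⟨i, hi⟩, j, hj⟩ := h (emb u)
    constructor
    · cases i with
      | none => exact absurd hi h1
      | some i => exact ⟨i, Or.inr ⟨hi, h1⟩⟩
    · cases j with
      | none => exact absurd (γ.trans' hj (γ.symm' h0)) h1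
      | some j => exact ⟨j, Or.inr ⟨hj, h1⟩⟩

theorem bar_unbar (γ : Setoid (Option X ⊕ Option X)) (h0 : γ (Sum.inl none) (Sum.inr none))
    (h : ∀ w, IsGenLine γ w) : (unbar γ h0 h).bar = γ := by
  have hon : ∀ w, (unbar γ h0 h).OnLine w ↔ ¬ γ w (Sum.inl none) := by
    intro w
    constructor
    · rintro ⟨u, rfl, hu⟩
      exact (isGenLine_unbar γ h0 h u).1 hu
    · intro hw
      rcases w with (_ | i) | (_ | j)
      · exact absurd (γ.refl' _) hw
      · exact ⟨Sum.inl i, rfl, (isGenLine_unbar γ h0 h (Sum.inl i)).2 hw⟩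
      · exact absurd (γ.symm' h0) hw
      · exact ⟨Sum.inr j, rfl, (isGenLine_unbar γ h0 h (Sum.inr j)).2 hw⟩
  apply Setoid.ext
  intro w z
  constructor
  · rintro (⟨u, v, rfl, rfl, -, h1⟩ | ⟨h1, h2⟩)
    · rcases h1 with rfl | ⟨h1, -⟩
      · exact γ.refl' _
      · exact h1
    · rw [hon, not_not] at h1 h2
      exact γ.trans' h1 (γ.symm' h2)
  · intro hwz
    by_cases hw : (unbar γ h0 h).OnLine w
    · have hz : (unbar γ h0 h).OnLine z := by
        rw [hon] at hw ⊢
        exact fun h3 => hw (γ.trans' hwz h3)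
      have hw' := (hon _).1 hw
      obtain ⟨u, rfl, hu⟩ := hw
      obtain ⟨v, rfl, -⟩ := hz
      exact Or.inl ⟨u, v, rfl, rfl, hu, Or.inr ⟨hwz, hw'⟩⟩
    · refine Or.inr ⟨hw, ?_⟩
      rw [hon] at hw ⊢
      exact fun h3 => hw (fun h4 => h3 (γ.trans' (γ.symm' hwz) h4))

theorem unbar_bar (α : PICarrier X) : unbar α.bar α.bar_none α.bar_genLine = α := by
  apply PICarrier.ext
  apply Setoid.ext
  intro u v
  constructor
  · rintro (rfl | ⟨⟨u', v', hu, hv, -, h⟩ | ⟨h1, h2⟩, h3⟩)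
    · exact α.part.refl' _
    · rw [emb_injective hu, emb_injective hv]; exact h
    · exact absurd (Or.inr ⟨h1, α.not_onLine_inl⟩) h3
  · intro h
    rcases α.pt_or_line u with hu | hu
    · exact Or.inl (hu v h).symm
    · refine Or.inr ⟨Or.inl ⟨u, v, rfl, rfl, hu, h⟩, ?_⟩
      rintro (⟨a, b, -, hb, -⟩ | ⟨h1, -⟩)
      · rcases b with b | b <;> simp [emb] at hb
      · exact h1 ⟨u, rfl, hu⟩

end PICarrier

theorem glue_left {X : Type*} {α β : Setoid (X ⊕ X)} {u v : X ⊕ X} (h : α u v) :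
    glue α β (Sum.map id Sum.inl u) (Sum.map id Sum.inl v) :=
  Relation.EqvGen.rel _ _ (Or.inl ⟨u, v, h, rfl, rfl⟩)

theorem glue_right {X : Type*} {α β : Setoid (X ⊕ X)} {u v : X ⊕ X} (h : β u v) :
    glue α β (Sum.inr u) (Sum.inr v) :=
  Relation.EqvGen.rel _ _ (Or.inr ⟨u, v, h, rfl, rfl⟩)

theorem natMul_genLine {X : Type*} {α β : Setoid (X ⊕ X)} (hα : ∀ u, IsGenLine α u)
    (hβ : ∀ u, IsGenLine β u) (u : X ⊕ X) : IsGenLine (natMul α β) u := by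
  have top : ∀ i : X, ∃ j, natMul α β (Sum.inl i) (Sum.inr j) := by
    intro i
    obtain ⟨-, m, hm⟩ := hα (Sum.inl i)
    obtain ⟨-, j, hj⟩ := hβ (Sum.inl m)
    exact ⟨j, (glue α β).trans' (glue_left hm) (glue_right hj)⟩
  have bot : ∀ j : X, ∃ i, natMul α β (Sum.inr j) (Sum.inl i) := by
    intro j
    obtain ⟨⟨m, hm⟩, -⟩ := hβ (Sum.inr j)
    obtain ⟨⟨i, hi⟩, -⟩ := hα (Sum.inr m)
    exact ⟨i, (glue α β).trans' (glue_right hm) (glue_left hi)⟩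
  rcases u with i | j
  · exact ⟨⟨i, (natMul α β).refl' _⟩, top i⟩
  · exact ⟨bot j, ⟨j, (natMul α β).refl' _⟩⟩

namespace PICarrier

variable {X : Type*}

theorem natMul_bar_none (α β : PICarrier X) :
    natMul α.bar β.bar (Sum.inl none) (Sum.inr none) :=
  (glue α.bar β.bar).trans' (glue_left α.bar_none) (glue_right β.bar_none)

/-- The product `⋆`: the element whose `bar` is the natural product of the `bar`s. -/
def star (α β : PICarrier X) : PICarrier X :=
  unbar (natMul α.bar β.bar) (natMul_bar_none α β) (natMul_genLine α.bar_genLine β.bar_genLine)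

theorem bar_star (α β : PICarrier X) : (star α β).bar = natMul α.bar β.bar := bar_unbar _ _ _

/-- The turned over diagram. -/
def flip (α : PICarrier X) : PICarrier X where
  part := α.part.comap Sum.swap
  pt_or_line u := by
    rcases α.pt_or_line u.swap with h | ⟨⟨i, hi⟩, j, hj⟩
    · refine Or.inl fun v hv => ?_
      have := congrArg Sum.swap (h v.swap hv)
      simpa using this
    · exact Or.inr ⟨⟨j, hj⟩, i, hi⟩

/-- The set `A ∪ B'`. -/
def pair (A B : Set X) : X ⊕ X → Prop := Sum.elim (· ∈ A) (· ∈ B)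

/-- `A ∪ B'` is one of the generalised lines of `α`. -/
def IsLine (α : PICarrier X) (A B : Set X) : Prop :=
  A.Nonempty ∧ B.Nonempty ∧ ∃ u, ∀ v, pair A B v ↔ α.part u v

theorem isLine_rel {α : PICarrier X} {A B : Set X} (h : α.IsLine A B) {u v : X ⊕ X}
    (hu : pair A B u) : pair A B v ↔ α.part u v := by
  obtain ⟨-, -, w, hw⟩ := h
  rw [hw] at hu ⊢
  exact ⟨fun h => α.part.trans' (α.part.symm' hu) h, fun h => α.part.trans' hu h⟩

theorem isLine_unique_right {α : PICarrier X} {A B B' : Set X} (h : α.IsLine A B)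
    (h' : α.IsLine A B') : B = B' := by
  obtain ⟨i, hi⟩ := h.1
  ext j
  have h1 := isLine_rel h (u := Sum.inl i) (v := Sum.inr j) hi
  have h2 := isLine_rel h' (u := Sum.inl i) (v := Sum.inr j) hi
  exact h1.trans h2.symm

theorem isLine_eq_of_mem {α : PICarrier X} {A B A' B' : Set X} (h : α.IsLine A B)
    (h' : α.IsLine A' B') {u : X ⊕ X} (hu : pair A B u) (hu' : pair A' B' u) :
    A = A' ∧ B = B' := by
  have : ∀ v, pair A B v ↔ pair A' B' v := fun v =>
    (isLine_rel h hu).trans (isLine_rel h' hu').symm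
  exact ⟨Set.ext fun i => this (Sum.inl i), Set.ext fun j => this (Sum.inr j)⟩

theorem exists_isLine {α : PICarrier X} {u : X ⊕ X} (h : IsGenLine α.part u) :
    ∃ A B, α.IsLine A B ∧ pair A B u := by
  obtain ⟨⟨i, hi⟩, j, hj⟩ := h
  refine ⟨{i | α.part u (Sum.inl i)}, {j | α.part u (Sum.inr j)},
    ⟨⟨i, hi⟩, ⟨j, hj⟩, u, ?_⟩, ?_⟩
  · rintro (v | v) <;> rfl
  · rcases u with u | u <;> exact α.part.refl' _

theorem isGenLine_of_isLine {α : PICarrier X} {A B : Set X} (h : α.IsLine A B) {u : X ⊕ X}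
    (hu : pair A B u) : IsGenLine α.part u := by
  obtain ⟨i, hi⟩ := h.1
  obtain ⟨j, hj⟩ := h.2.1
  exact ⟨⟨i, (isLine_rel h hu).1 hi⟩, j, (isLine_rel h hu).1 hj⟩

theorem isLine_flip (α : PICarrier X) (A B : Set X) : α.flip.IsLine A B ↔ α.IsLine B A := by
  have key : ∀ (α : PICarrier X) (A B : Set X), α.IsLine B A → α.flip.IsLine A B := by
    rintro α A B ⟨h1, h2, u, hu⟩
    refine ⟨h2, h1, u.swap, fun v => ?_⟩
    change pair A B v ↔ α.part u.swap.swap v.swap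
    rw [Sum.swap_swap, ← hu]
    rcases v with v | v <;> rfl
  refine ⟨fun h => ?_, key α A B⟩
  have h2 := key α.flip B A h
  have : α.flip.flip = α := by
    apply PICarrier.ext
    apply Setoid.ext
    intro u v
    change α.part u.swap.swap v.swap.swap ↔ _
    rw [Sum.swap_swap, Sum.swap_swap]
  rwa [this] at h2

/-- An element is determined by its generalised lines. -/
theorem ext_isLine {α β : PICarrier X} (h : ∀ A B, α.IsLine A B ↔ β.IsLine A B) : α = β := by
  have key : ∀ {α β : PICarrier X}, (∀ A B, α.IsLine A B ↔ β.IsLine A B) →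
      ∀ u v, α.part u v → β.part u v := by
    intro α β h u v huv
    rcases α.pt_or_line u with hu | hu
    · rw [hu v huv]
    · obtain ⟨A, B, hl, hu'⟩ := exists_isLine hu
      exact (isLine_rel ((h A B).1 hl) hu').1 ((isLine_rel hl hu').2 huv)
  apply PICarrier.ext
  apply Setoid.ext
  intro u v
  exact ⟨key h u v, key (fun A B => (h A B).symm) u v⟩

/-- The product `∘`: the generalised lines of `α ∘ β` are the sets `A ∪ C'` such that, for
some `B`, `A ∪ B'` is a generalised line of `α` and `B ∪ C'` is a generalised line of `β`. -/
def circ (α β : PICarrier X) : PICarrier X where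
  part :=
    { r := fun u v => u = v ∨
        ∃ A B C, α.IsLine A B ∧ β.IsLine B C ∧ pair A C u ∧ pair A C v
      iseqv := by
        refine ⟨fun u => Or.inl rfl, ?_, ?_⟩
        · rintro u v (rfl | ⟨A, B, C, h1, h2, hu, hv⟩)
          · exact Or.inl rfl
          · exact Or.inr ⟨A, B, C, h1, h2, hv, hu⟩
        · rintro u v w (rfl | ⟨A, B, C, h1, h2, hu, hv⟩)
            (rfl | ⟨A', B', C', h1', h2', hv', hw⟩)
          · exact Or.inl rfl
          · exact Or.inr ⟨A', B', C', h1', h2', hv', hw⟩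
          · exact Or.inr ⟨A, B, C, h1, h2, hu, hv⟩
          · have : A = A' ∧ C = C' := by
              rcases v with v | v
              · have e := isLine_eq_of_mem h1 h1' (u := Sum.inl v) hv hv'
                obtain ⟨rfl, rfl⟩ := e
                exact ⟨rfl, isLine_unique_right h2 h2'⟩
              · have e := isLine_eq_of_mem h2 h2' (u := Sum.inr v) hv hv'
                obtain ⟨rfl, rfl⟩ := e
                exact ⟨isLine_unique_right ((isLine_flip _ _ _).2 h1)
                  ((isLine_flip _ _ _).2 h1'), rfl⟩
            obtain ⟨rfl, rfl⟩ := this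
            exact Or.inr ⟨A, B, C, h1, h2, hu, hw⟩ }
  pt_or_line u := by
    by_cases h : ∃ A B C, α.IsLine A B ∧ β.IsLine B C ∧ pair A C u
    · obtain ⟨A, B, C, h1, h2, hu⟩ := h
      obtain ⟨i, hi⟩ := h1.1
      obtain ⟨j, hj⟩ := h2.2.1
      exact Or.inr ⟨⟨i, Or.inr ⟨A, B, C, h1, h2, hu, hi⟩⟩,
        j, Or.inr ⟨A, B, C, h1, h2, hu, hj⟩⟩
    · left
      rintro v (rfl | ⟨A, B, C, h1, h2, hu, -⟩)
      · rfl
      · exact absurd ⟨A, B, C, h1, h2, hu⟩ h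

theorem isLine_circ (α β : PICarrier X) (A C : Set X) :
    (circ α β).IsLine A C ↔ ∃ B, α.IsLine A B ∧ β.IsLine B C := by
  have key : ∀ {A B C}, α.IsLine A B → β.IsLine B C → (circ α β).IsLine A C := by
    intro A B C h1 h2
    obtain ⟨i, hi⟩ := h1.1
    refine ⟨h1.1, h2.2.1, Sum.inl i, fun v => ⟨fun hv => Or.inr ⟨A, B, C, h1, h2, hi, hv⟩, ?_⟩⟩
    rintro (rfl | ⟨A', B', C', h1', h2', hu, hv⟩)
    · exact hi
    · obtain ⟨rfl, rfl⟩ := isLine_eq_of_mem h1 h1' (u := Sum.inl i) hi hu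
      obtain rfl := isLine_unique_right h2 h2'
      exact hv
  constructor
  · intro h
    obtain ⟨i, hi⟩ := h.1
    obtain ⟨j, hj⟩ := h.2.1
    have h3 : (circ α β).part (Sum.inl i) (Sum.inr j) :=
      (isLine_rel h (u := Sum.inl i) (v := Sum.inr j) hi).1 hj
    rcases h3 with h3 | ⟨A', B', C', h1', h2', hu, hv⟩
    · cases h3
    · obtain ⟨rfl, rfl⟩ := isLine_eq_of_mem h (key h1' h2') (u := Sum.inl i) hi hu
      exact ⟨B', h1', h2'⟩
  · rintro ⟨B, h1, h2⟩
    exact key h1 h2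

/-- The cross relation that characterises `∘`: `i` and `j'` are in one block of `α ∘ β` iff
`i` is in a generalised line `A ∪ B'` of `α` and `j'` is in a generalised line `B ∪ C'` of `β`
with the same middle set `B`. -/
theorem circ_cross (α β : PICarrier X) (i j : X) :
    (circ α β).part (Sum.inl i) (Sum.inr j) ↔
      ∃ A B C, α.IsLine A B ∧ β.IsLine B C ∧ i ∈ A ∧ j ∈ C := by
  constructor
  · rintro (h | ⟨A, B, C, h1, h2, hu, hv⟩)
    · cases h
    · exact ⟨A, B, C, h1, h2, hu, hv⟩
  · rintro ⟨A, B, C, h1, h2, hu, hv⟩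
    exact Or.inr ⟨A, B, C, h1, h2, hu, hv⟩

/-- `U` is a union of blocks. -/
def Saturated {T : Type*} (σ : Setoid T) (U : T → Prop) : Prop := ∀ u v, σ u v → U u → U v

/-- `A ∪ B'` is a union of generalised lines of `α`. -/
def IsLines (α : PICarrier X) (A B : Set X) : Prop :=
  Saturated α.part (pair A B) ∧ ∀ u, pair A B u → IsGenLine α.part u

/-- The predicate on `Option X` of lying in `A`. -/
def optPred (A : Set X) : Option X → Prop := fun o => ∃ i ∈ A, o = some i

theorem pair_iff (A B : Set X) (u : X ⊕ X) :
    Sum.elim (optPred A) (optPred B) (emb u) ↔ pair A B u := by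
  rcases u with u | u <;> simp [emb, optPred, pair]

theorem exists_emb {A B : Set X} {w : Option X ⊕ Option X}
    (h : Sum.elim (optPred A) (optPred B) w) : ∃ u, w = emb u ∧ pair A B u := by
  rcases w with w | w
  · obtain ⟨i, hi, rfl⟩ := h
    exact ⟨Sum.inl i, rfl, hi⟩
  · obtain ⟨i, hi, rfl⟩ := h
    exact ⟨Sum.inr i, rfl, hi⟩

theorem isLines_iff (α : PICarrier X) (A B : Set X) :
    α.IsLines A B ↔ Saturated α.bar (Sum.elim (optPred A) (optPred B)) := by
  constructor
  · rintro ⟨h1, h2⟩ w z hwz hw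
    obtain ⟨u, rfl, hu⟩ := exists_emb hw
    rcases hwz with ⟨u', v, e, rfl, -, h⟩ | ⟨h3, -⟩
    · obtain rfl := emb_injective e
      exact (pair_iff _ _ _).2 (h1 _ _ h hu)
    · exact absurd ⟨u, rfl, h2 u hu⟩ h3
  · intro h
    have h2 : ∀ u, pair A B u → IsGenLine α.part u := by
      intro u hu
      by_contra hc
      have h3 : α.bar (emb u) (Sum.inl none) := by
        refine Or.inr ⟨?_, α.not_onLine_inl⟩
        rintro ⟨u', e, hu'⟩
        exact hc (emb_injective e ▸ hu')
      obtain ⟨i, -, hi⟩ := h _ _ h3 ((pair_iff A B u).2 hu)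
      cases hi
    refine ⟨fun u v huv hu => ?_, h2⟩
    exact (pair_iff _ _ _).1
      (h (emb u) (emb v) (Or.inl ⟨u, v, rfl, rfl, h2 u hu, huv⟩) ((pair_iff _ _ _).2 hu))

theorem saturated_natMul {Y : Type*} (σ τ : Setoid (Y ⊕ Y)) (P R : Y → Prop) :
    Saturated (natMul σ τ) (Sum.elim P R) ↔
      ∃ Q, Saturated σ (Sum.elim P Q) ∧ Saturated τ (Sum.elim Q R) := by
  constructor
  · intro h
    have hs : ∀ {p q}, glue σ τ p q → glue σ τ q p := fun h => (glue σ τ).symm' h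
    have ht : ∀ {p q r}, glue σ τ p q → glue σ τ q r → glue σ τ p r :=
      fun h h' => (glue σ τ).trans' h h'
    refine ⟨fun m => ∃ u : Y ⊕ Y, Sum.elim P R u ∧
      glue σ τ (Sum.map id Sum.inr u) (Sum.inr (Sum.inl m)), ?_, ?_⟩
    · rintro (u | u) (v | v) huv hu
      · exact h (Sum.inl u) (Sum.inl v) (glue_left huv) hu
      · exact ⟨Sum.inl u, hu, glue_left huv⟩
      · obtain ⟨w, hw, hwu⟩ := hu
        exact h w (Sum.inl v) (ht hwu (glue_left huv)) hw
      · obtain ⟨w, hw, hwu⟩ := hu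
        exact ⟨w, hw, ht hwu (glue_left huv)⟩
    · rintro (u | u) (v | v) huv hu
      · obtain ⟨w, hw, hwu⟩ := hu
        exact ⟨w, hw, ht hwu (glue_right huv)⟩
      · obtain ⟨w, hw, hwu⟩ := hu
        exact h w (Sum.inr v) (ht hwu (glue_right huv)) hw
      · exact ⟨Sum.inr u, hu, glue_right huv⟩
      · exact h (Sum.inr u) (Sum.inr v) (glue_right huv) hu
  · rintro ⟨Q, h1, h2⟩
    have key : ∀ p q, glue σ τ p q →
        (Sum.elim P (Sum.elim Q R) p ↔ Sum.elim P (Sum.elim Q R) q) := by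
      intro p q h
      induction h with
      | rel p q h =>
        rcases h with ⟨u, v, h, rfl, rfl⟩ | ⟨u, v, h, rfl, rfl⟩
        · have e : ∀ w : Y ⊕ Y, Sum.elim P (Sum.elim Q R) (Sum.map id Sum.inl w) ↔
              Sum.elim P Q w := by rintro (w | w) <;> rfl
          rw [e, e]
          exact ⟨h1 _ _ h, h1 _ _ (σ.symm' h)⟩
        · exact ⟨h2 _ _ h, h2 _ _ (τ.symm' h)⟩
      | refl => rfl
      | symm _ _ _ ih => exact ih.symm
      | trans _ _ _ _ _ ih1 ih2 => exact ih1.trans ih2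
    intro u v huv hu
    have e : ∀ w : Y ⊕ Y, Sum.elim P (Sum.elim Q R) (Sum.map id Sum.inr w) ↔
        Sum.elim P R w := by rintro (w | w) <;> rfl
    exact (e v).1 ((key _ _ huv).1 ((e u).2 hu))

theorem isLines_star (α β : PICarrier X) (A C : Set X) :
    (star α β).IsLines A C ↔ ∃ B, α.IsLines A B ∧ β.IsLines B C := by
  rw [isLines_iff, bar_star, saturated_natMul]
  constructor
  · rintro ⟨Q, h1, h2⟩
    have hQ : Q = optPred {i | Q (some i)} := by
      funext o
      cases o with
      | none =>
        simp only [optPred, eq_iff_iff, reduceCtorEq, and_false, exists_false, iff_false]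
        intro hq
        obtain ⟨i, -, hi⟩ := h1 _ _ (α.bar.symm' α.bar_none) hq
        cases hi
      | some i => simp [optPred]
    rw [hQ] at h1 h2
    exact ⟨_, (isLines_iff _ _ _).2 h1, (isLines_iff _ _ _).2 h2⟩
  · rintro ⟨B, h1, h2⟩
    exact ⟨_, (isLines_iff _ _ _).1 h1, (isLines_iff _ _ _).1 h2⟩

theorem isLines_flip (α : PICarrier X) (A B : Set X) : α.flip.IsLines A B ↔ α.IsLines B A := by
  have e : ∀ (A B : Set X) u, pair A B (Sum.swap u) ↔ pair B A u := by
    rintro A B (u | u) <;> rfl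
  have e2 : ∀ u, IsGenLine α.flip.part u ↔ IsGenLine α.part u.swap := fun u => and_comm
  constructor
  · rintro ⟨h1, h2⟩
    refine ⟨fun u v huv hu => ?_, fun u hu => ?_⟩
    · rw [← e] at hu ⊢
      refine h1 _ _ ?_ hu
      change α.part u.swap.swap v.swap.swap
      rwa [Sum.swap_swap, Sum.swap_swap]
    · have := h2 u.swap ((e A B u).2 hu)
      rwa [e2, Sum.swap_swap] at this
  · rintro ⟨h1, h2⟩
    refine ⟨fun u v huv hu => ?_, fun u hu => ?_⟩
    · rw [← e] at hu ⊢
      exact h1 _ _ huv hu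
    · exact (e2 u).2 (h2 _ ((e B A u).2 hu))

theorem isLines_unique_right {α : PICarrier X} {A B B' : Set X} (h : α.IsLines A B)
    (h' : α.IsLines A B') : B = B' := by
  have key : ∀ {B B' : Set X}, α.IsLines A B → α.IsLines A B' → B ⊆ B' := by
    intro B B' h h' j hj
    obtain ⟨⟨i, hi⟩, -⟩ := h.2 (Sum.inr j) hj
    exact h'.1 (Sum.inl i) (Sum.inr j) (α.part.symm' hi) (h.1 _ (Sum.inl i) hi hj)
  exact (key h h').antisymm (key h' h)

theorem isLines_of_isLine {α : PICarrier X} {A B : Set X} (h : α.IsLine A B) :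
    α.IsLines A B :=
  ⟨fun _ _ huv hu => (isLine_rel h hu).2 huv, fun _ hu => isGenLine_of_isLine h hu⟩

theorem ext_isLines {α β : PICarrier X} (h : ∀ A B, α.IsLines A B ↔ β.IsLines A B) : α = β := by
  have key : ∀ {α β : PICarrier X}, (∀ A B, α.IsLines A B ↔ β.IsLines A B) →
      ∀ u v, α.part u v → β.part u v := by
    intro α β h u v huv
    rcases α.pt_or_line u with hu | hu
    · rw [hu v huv]
    · obtain ⟨A, B, hl, hu'⟩ := exists_isLine hu
      have h1 := (h A B).1 (isLines_of_isLine hl)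
      have hv' : pair A B v := (isLine_rel hl hu').2 huv
      obtain ⟨C, D, hl', hu''⟩ := exists_isLine (h1.2 u hu')
      have h2 := (h C D).2 (isLines_of_isLine hl')
      have hv'' : pair C D v := h2.1 u v huv hu''
      exact (isLine_rel hl' hu'').1 hv''
  apply PICarrier.ext
  apply Setoid.ext
  intro u v
  exact ⟨key h u v, key (fun A B => (h A B).symm) u v⟩

end PICarrier

/-- The semigroup of partitions of `X ∪ X'` into points and generalised lines, with
multiplication `⋆`. -/
def PIStar (X : Type*) : Type _ := PICarrier X

/-- The semigroup of partitions of `X ∪ X'` into points and generalised lines, with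
multiplication `∘`. -/
def PIBar (X : Type*) : Type _ := PICarrier X

instance (X : Type*) : Mul (PIStar X) := ⟨PICarrier.star⟩

instance (X : Type*) : Inv (PIStar X) := ⟨PICarrier.flip⟩

instance (X : Type*) : Mul (PIBar X) := ⟨PICarrier.circ⟩

instance (X : Type*) : Inv (PIBar X) := ⟨PICarrier.flip⟩

instance (X : Type*) : InverseSemigroup (PIStar X) :=
  InverseSemigroup.ofRel (P := Set X) PICarrier.IsLines
    (fun _ _ h => PICarrier.ext_isLines fun A B => iff_of_eq (congrFun (congrFun h A) B))
    (fun _ _ _ _ h h' => PICarrier.isLines_unique_right h h')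
    PICarrier.isLines_flip PICarrier.isLines_star

instance (X : Type*) : InverseSemigroup (PIBar X) :=
  InverseSemigroup.ofRel (P := Set X) PICarrier.IsLine
    (fun _ _ h => PICarrier.ext_isLine fun A B => iff_of_eq (congrFun (congrFun h A) B))
    (fun _ _ _ _ h h' => PICarrier.isLine_unique_right h h')
    PICarrier.isLine_flip PICarrier.isLine_circ

/-! Both semigroups act on the nonempty subsets of $N$: an element sends $A$ to $B$ when $A\cup B'$
is a union of its generalised lines (for $\star$), respectively one of its generalised lines (for
$\circ$). Either action is faithful, and its image contains the empty map and, for all $A$, $B$, the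
map $e_{AB}$ defined only at $A$ and sending it to $B$; it comes from the partition with the single
line $A\cup B'$. There are $2^n-1$ points.

Everything else holds for any inverse semigroup $S$ acting faithfully on a nonempty set $P$ with all
partial bijections of rank at most one in the image (`RankOneRep`). The primitive idempotents are
the $e_{pp}$, and $e_{pp}\omega$ is the stabiliser of $p$. A faithful transitive representation
$\sigma$ on $Y$ must send zero to the empty map. Hence each $y\in Y$ is fixed by exactly one
$e_{pp}$, and $y\mapsto p$ is an equivalence with the given action (`equivalentRep`).

The coset representations are then covered too: $\phi_H$ is transitive and $H$ is the stabiliser of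
the coset $H$. If $\phi_H$ is faithful, the equivalence turns $H$ into the stabiliser of a point of
$P$, which is some $e_{pp}\omega$ (`exists_eq_above`). Conversely, the cosets of $e_{pp}\omega$
correspond to the points of $P$, which gives faithfulness (`faithful_cosetRep_above`). -/

/-! ### Representations of inverse semigroups by partial bijections -/

namespace SymInv

variable {Y : Type*}

theorem Maps.right_unique {f : SymInv Y} {x y y' : Y} (h : f.Maps x y) (h' : f.Maps x y') :
    y = y' := Option.mem_unique h h'

theorem Maps.left_unique {f : SymInv Y} {x x' y : Y} (h : f.Maps x y) (h' : f.Maps x' y) :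
    x = x' := PEquiv.inj (show Y ≃. Y from f) h h'

end SymInv

section Rep

variable {S Y : Type*} [InverseSemigroup S] (σ : S →ₙ* SymInv Y)

theorem rep_maps_mul (a b : S) (x z : Y) :
    (σ (a * b)).Maps x z ↔ ∃ y, (σ a).Maps x y ∧ (σ b).Maps y z := by
  rw [map_mul, SymInv.maps_mul]

/-- Splitting $e=ee$ gives $x\to z\to y$ beside $x\to y$: single-valuedness yields $z=y$ and
injectivity yields $x=z$. -/
theorem eq_of_rep_idem_maps {e : S} (he : e * e = e) {x y : Y} (h : (σ e).Maps x y) : x = y := by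
  have h' := h
  rw [← he, rep_maps_mul] at h'
  obtain ⟨z, hxz, hzy⟩ := h'
  exact (h.right_unique hxz) ▸ h.left_unique hzy

theorem rep_maps_of_natLE {a b : S} (hab : NatLE a b) {x y : Y} (h : (σ a).Maps x y) :
    (σ b).Maps x y := by
  obtain ⟨e, he, rfl⟩ := hab
  obtain ⟨z, hxz, hzy⟩ := (rep_maps_mul σ _ _ _ _).1 h
  rwa [eq_of_rep_idem_maps σ he hxz]

/-- Since $a=aa^{-1}a$, the arrow $x\to y$ factors as $x\to u\to v\to y$, where $u=y$ and $v=x$ are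
forced. -/
theorem rep_maps_inv {a : S} {x y : Y} (h : (σ a).Maps x y) : (σ a⁻¹).Maps y x := by
  have h' := h
  rw [← InverseSemigroup.mul_inv_mul a] at h'
  obtain ⟨v, h1, hv⟩ := (rep_maps_mul σ _ _ _ _).1 h'
  obtain ⟨u, hu, huv⟩ := (rep_maps_mul σ _ _ _ _).1 h1
  rw [h.right_unique hu]
  rwa [← h.left_unique hv] at huv

end Rep

/-! ### Coset representations: transitivity and stabilisers -/

namespace ClosedInvSubsemigroup

open InverseSemigroup

variable {S : Type*} [InverseSemigroup S] (H : ClosedInvSubsemigroup S)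

theorem cosetSet_mul_of_mem {h : S} (hh : h ∈ H.carrier) (y : S) :
    H.cosetSet (h * y) = H.cosetSet y := by
  apply Set.Subset.antisymm
  · exact H.cosetSet_subset ⟨h, hh, InverseSemigroup.le_refl _⟩
  · refine H.cosetSet_subset ⟨h⁻¹, H.inv_mem' hh, ?_⟩
    rw [← mul_assoc]
    exact idem_mul_le (inv_mul_idem h) y

theorem cosetSet_of_mem {h : S} (hh : h ∈ H.carrier) : H.cosetSet h = H.carrier := by
  ext t
  constructor
  · rintro ⟨k, hk, hkt⟩
    exact H.up_mem' (H.mul_mem' hk hh) hkt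
  · intro ht
    refine ⟨t * h⁻¹, H.mul_mem' ht (H.inv_mem' hh), ?_⟩
    rw [mul_assoc]
    exact mul_idem_le (inv_mul_idem h) t

theorem cosetRep_transitive : IsTransitiveRep H.cosetRep := by
  rintro ⟨A, x, hx, rfl⟩ ⟨B, y, -, rfl⟩
  -- Here $x(x^{-1}y)=(xx^{-1})y$, and the factor $xx^{-1}\in H$ is absorbed by the coset.
  refine ⟨x⁻¹ * y, (H.cosetRep_maps _ _ _).2 ⟨x, rfl, ?_⟩⟩
  rw [← mul_assoc]
  exact (H.cosetSet_mul_of_mem hx y).symm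

/-- `H` is the stabiliser of one of its cosets, namely `H` itself. -/
theorem exists_coset_stabilizer :
    ∃ A : H.Cosets, ∀ s, (H.cosetRep s).Maps A A ↔ s ∈ H.carrier := by
  obtain ⟨e, he, hee⟩ := H.exists_idem_mem
  refine ⟨⟨H.carrier, e, by rwa [inv_of_idem hee, hee], (H.cosetSet_of_mem he).symm⟩,
    fun s => ?_⟩
  refine (H.cosetRep_maps _ _ _).trans ?_
  constructor
  · rintro ⟨x, hx, hxs⟩
    have h1 : x ∈ H.carrier := by
      change H.carrier = _ at hx
      rw [hx]; exact H.self_mem_cosetSet x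
    have h2 : x * s ∈ H.carrier := by
      change H.carrier = _ at hxs
      rw [hxs]; exact H.self_mem_cosetSet _
    refine H.up_mem' (H.mul_mem' (H.inv_mem' h1) h2) ?_
    rw [← mul_assoc]
    exact idem_mul_le (inv_mul_idem x) s
  · intro hs
    exact ⟨e, (H.cosetSet_of_mem he).symm, (H.cosetSet_of_mem (H.mul_mem' he hs)).symm⟩

end ClosedInvSubsemigroup

/-! ### Actions containing all partial bijections of rank at most one -/

/-- A faithful representation of `S` on `P` whose image contains all partial bijections of
rank at most one. -/
structure RankOneRep (S P : Type*) [InverseSemigroup S] where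
  rep : S →ₙ* SymInv P
  faithful : IsFaithfulRep rep
  zero : S
  not_maps_zero : ∀ x y, ¬ (rep zero).Maps x y
  unit : P → P → S
  maps_unit : ∀ p q x y, (rep (unit p q)).Maps x y ↔ x = p ∧ y = q

namespace RankOneRep

open InverseSemigroup

variable {S P : Type*} [InverseSemigroup S] (R : RankOneRep S P)

/-- A family of partial bijections, given as relations, that separates the elements of `S`,
is closed under composition and contains the relations of rank at most one. -/
noncomputable def ofRel (f : S → P → P → Prop) (hinj : Function.Injective f)
    (hfun : ∀ a p q q', f a p q → f a p q' → q = q')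
    (hinv : ∀ a p q, f a⁻¹ p q ↔ f a q p)
    (hmul : ∀ a b p r, f (a * b) p r ↔ ∃ q, f a p q ∧ f b q r)
    (zero : S) (hzero : ∀ p q, ¬ f zero p q)
    (unit : P → P → S) (hunit : ∀ p q x y, f (unit p q) x y ↔ x = p ∧ y = q) :
    RankOneRep S P :=
  have hinj' : ∀ a p p' q, f a p q → f a p' q → p = p' := fun a p p' q h h' =>
    hfun a⁻¹ q p p' ((hinv _ _ _).2 h) ((hinv _ _ _).2 h')
  { rep :=
      { toFun := fun a => SymInv.ofRel (f a) (hfun a) (hinj' a)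
        map_mul' := fun a b => SymInv.ext fun x y => by
          rw [SymInv.maps_mul]
          simp only [SymInv.maps_ofRel, hmul] }
    faithful := fun a b hab => hinj <| by
      funext x y
      have h1 := SymInv.maps_ofRel (f a) (hfun a) (hinj' a) x y
      have h2 := SymInv.maps_ofRel (f b) (hfun b) (hinj' b) x y
      have h3 : SymInv.ofRel (f a) (hfun a) (hinj' a) = SymInv.ofRel (f b) (hfun b) (hinj' b) :=
        hab
      rw [eq_iff_iff, ← h1, ← h2, h3]
    zero := zero
    not_maps_zero := fun x y h =>
      hzero x y ((SymInv.maps_ofRel (f zero) (hfun zero) (hinj' zero) x y).1 h)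
    unit := unit
    maps_unit := fun p q x y =>
      (SymInv.maps_ofRel _ (hfun (unit p q)) (hinj' (unit p q)) x y).trans (hunit p q x y) }

theorem ext_maps {a b : S} (h : ∀ x y, (R.rep a).Maps x y ↔ (R.rep b).Maps x y) : a = b :=
  R.faithful (SymInv.ext h)

theorem maps_unit_self (p q : P) : (R.rep (R.unit p q)).Maps p q :=
  (R.maps_unit _ _ _ _).2 ⟨rfl, rfl⟩

theorem isZeroElt_zero : IsZeroElt R.zero := fun s => by
  constructor <;> refine R.ext_maps fun x y => ?_ <;>
    simp only [rep_maps_mul, R.not_maps_zero, false_and, and_false, exists_false]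

theorem unit_mul_of_maps {s : S} {p q r : P} (h : (R.rep s).Maps q r) :
    R.unit p q * s = R.unit p r := R.ext_maps fun x y => by
  simp only [rep_maps_mul, R.maps_unit]
  constructor
  · rintro ⟨_, ⟨rfl, rfl⟩, h'⟩
    exact ⟨rfl, h'.right_unique h⟩
  · rintro ⟨rfl, rfl⟩
    exact ⟨q, ⟨rfl, rfl⟩, h⟩

theorem unit_mul_of_not_maps {s : S} {p q : P} (h : ∀ r, ¬ (R.rep s).Maps q r) :
    R.unit p q * s = R.zero := R.ext_maps fun x y => by
  simp only [rep_maps_mul, R.maps_unit, R.not_maps_zero, iff_false]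
  rintro ⟨_, ⟨rfl, rfl⟩, h'⟩
  exact h _ h'

theorem unit_mul_unit (p q r : P) : R.unit p q * R.unit q r = R.unit p r :=
  R.unit_mul_of_maps (R.maps_unit_self q r)

theorem unit_ne_zero (p q : P) : R.unit p q ≠ R.zero := fun h =>
  R.not_maps_zero p q (h ▸ R.maps_unit_self p q)

theorem not_isZeroElt_unit (p q : P) : ¬ IsZeroElt (R.unit p q) := fun h =>
  R.unit_ne_zero p q ((h R.zero).1.symm.trans (R.isZeroElt_zero _).2)

/-- This identifies the closed inverse subsemigroup $e_{pp}\omega$ with the stabiliser of $p$. -/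
theorem unit_natLE_iff {s : S} {p : P} : NatLE (R.unit p p) s ↔ (R.rep s).Maps p p := by
  refine ⟨fun h => rep_maps_of_natLE R.rep h (R.maps_unit_self p p), fun h => ?_⟩
  exact ⟨R.unit p p, R.unit_mul_unit p p p, (R.unit_mul_of_maps h).symm⟩

/-- Idempotents act as partial identities. A nonzero one fixes some $p$, hence lies above $e_{pp}$,
and minimality gives equality. Below $e_{pp}$ there is only room for $e_{pp}$ itself and the empty
map. -/
theorem isPrimitiveIdem_iff {e : S} : IsPrimitiveIdem e ↔ ∃ p, e = R.unit p p := by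
  constructor
  · rintro ⟨hee, hne, hmin⟩
    have : ∃ x y, (R.rep e).Maps x y := by
      by_contra! hc
      apply hne
      have : e = R.zero := R.ext_maps fun x y => iff_of_false (hc x y) (R.not_maps_zero x y)
      exact this ▸ R.isZeroElt_zero
    obtain ⟨p, q, hpq⟩ := this
    obtain rfl := eq_of_rep_idem_maps R.rep hee hpq
    refine ⟨p, ?_⟩
    rcases hmin _ (R.unit_mul_unit p p p) (R.unit_natLE_iff.2 hpq) with h | h
    · exact absurd h (R.not_isZeroElt_unit p p)
    · exact h.symm
  · rintro ⟨p, rfl⟩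
    refine ⟨R.unit_mul_unit p p p, R.not_isZeroElt_unit p p, fun f hf hle => ?_⟩
    by_cases h : (R.rep f).Maps p p
    · right
      refine R.ext_maps fun x y => ⟨rep_maps_of_natLE R.rep hle, fun hxy => ?_⟩
      obtain ⟨rfl, rfl⟩ := (R.maps_unit _ _ _ _).1 hxy
      exact h
    · left
      have : f = R.zero := by
        refine R.ext_maps fun x y => iff_of_false (fun hxy => h ?_) (R.not_maps_zero x y)
        obtain ⟨rfl, rfl⟩ := (R.maps_unit _ _ _ _).1 (rep_maps_of_natLE R.rep hle hxy)
        exact hxy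
      exact this ▸ R.isZeroElt_zero

theorem rep_transitive : IsTransitiveRep R.rep := fun p q => ⟨_, R.maps_unit_self p q⟩

theorem rep_effective : IsEffectiveRep R.rep := fun p => ⟨_, p, R.maps_unit_self p p⟩

/-! ### Uniqueness of the faithful transitive representation -/

section Uniqueness

variable {Y : Type*} {σ : S →ₙ* SymInv Y}

/-- If zero acted nontrivially it would fix some $y$. From $0s=0$ and transitivity, $Y=\{y\}$; from
$s0=0$, every $s$ fixes $y$. Then all elements act alike, although $e_{pp}\ne0$. -/
theorem not_maps_zero_of_faithful [Nonempty P] (hf : IsFaithfulRep σ) (ht : IsTransitiveRep σ)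
    (y z : Y) : ¬ (σ R.zero).Maps y z := by
  intro h
  have hz := R.isZeroElt_zero
  obtain rfl := eq_of_rep_idem_maps σ (hz _).1 h
  have hY : ∀ w, w = y := by
    intro w
    obtain ⟨s, hs⟩ := ht y w
    have h' : (σ (R.zero * s)).Maps y w := (rep_maps_mul σ _ _ _ _).2 ⟨y, h, hs⟩
    rw [(hz s).1] at h'
    exact h'.right_unique h
  have hS : ∀ s, (σ s).Maps y y := by
    intro s
    have h' := h
    rw [← (hz s).2] at h'
    obtain ⟨w, hw, -⟩ := (rep_maps_mul σ _ _ _ _).1 h'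
    rwa [hY w] at hw
  obtain ⟨p⟩ := ‹Nonempty P›
  refine R.unit_ne_zero p p (hf (SymInv.ext fun u v => ?_))
  rw [hY u, hY v]
  exact iff_of_true (hS _) (hS _)

/-- Otherwise $e_{pp}$ would act as the empty map, exactly as zero does. -/
theorem exists_maps_unit (h0 : ∀ y z, ¬ (σ R.zero).Maps y z) (hf : IsFaithfulRep σ) (p : P) :
    ∃ y, (σ (R.unit p p)).Maps y y := by
  by_contra! hc
  refine R.unit_ne_zero p p (hf (SymInv.ext fun u v => iff_of_false (fun h => ?_) (h0 u v)))
  obtain rfl := eq_of_rep_idem_maps σ (R.unit_mul_unit p p p) h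
  exact hc _ h

/-- Some $e_{pp}$ fixes a point $y_0$, and some $s$ carries $y_0$ to $y$. So $e_{pp}s$ is not zero
and must be some $e_{pq}=e_{pq}e_{qq}$, which makes $e_{qq}$ fix $y$. -/
theorem exists_unit_maps [Nonempty P] (h0 : ∀ y z, ¬ (σ R.zero).Maps y z) (hf : IsFaithfulRep σ)
    (ht : IsTransitiveRep σ) (y : Y) : ∃ p, (σ (R.unit p p)).Maps y y := by
  obtain ⟨p⟩ := ‹Nonempty P›
  obtain ⟨y₀, hy₀⟩ := R.exists_maps_unit h0 hf p
  obtain ⟨s, hs⟩ := ht y₀ y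
  have h := (rep_maps_mul σ _ _ _ _).2 ⟨y₀, hy₀, hs⟩
  by_cases hc : ∃ q, (R.rep s).Maps p q
  · obtain ⟨q, hq⟩ := hc
    rw [R.unit_mul_of_maps hq, ← R.unit_mul_unit p q q] at h
    obtain ⟨w, -, hw⟩ := (rep_maps_mul σ _ _ _ _).1 h
    obtain rfl := eq_of_rep_idem_maps σ (R.unit_mul_unit q q q) hw
    exact ⟨q, hw⟩
  · rw [R.unit_mul_of_not_maps (not_exists.1 hc)] at h
    exact absurd h (h0 _ _)

/-- The product $e_{pp}(s\,e_{qq})$ carries $y$ to $z$ under $\sigma$, so it is not zero; but it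
would be zero if $s$ did not send $p$ to $q$. -/
theorem rep_maps_of_maps (h0 : ∀ y z, ¬ (σ R.zero).Maps y z) {y z : Y} {p q : P}
    (hy : (σ (R.unit p p)).Maps y y) (hz : (σ (R.unit q q)).Maps z z) {s : S}
    (hs : (σ s).Maps y z) : (R.rep s).Maps p q := by
  have h := (rep_maps_mul σ _ _ _ _).2 ⟨y, hy, (rep_maps_mul σ _ _ _ _).2 ⟨z, hs, hz⟩⟩
  by_contra hc
  refine h0 y z ?_
  rwa [R.unit_mul_of_not_maps] at h
  intro r hr
  obtain ⟨w, hw, hwr⟩ := (rep_maps_mul _ _ _ _ _).1 hr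
  obtain ⟨rfl, rfl⟩ := (R.maps_unit _ _ _ _).1 hwr
  exact hc hw

/-- Take any $t$ carrying $y$ to $z$. By `rep_maps_of_maps` it sends $p$ to $q$, as $s$ does, so
$e_{pp}t=e_{pq}=e_{pp}s\le s$; hence $s$ too carries $y$ to $z$. -/
theorem maps_of_rep_maps (h0 : ∀ y z, ¬ (σ R.zero).Maps y z) (ht : IsTransitiveRep σ) {y z : Y}
    {p q : P} (hy : (σ (R.unit p p)).Maps y y) (hz : (σ (R.unit q q)).Maps z z) {s : S}
    (hs : (R.rep s).Maps p q) : (σ s).Maps y z := by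
  obtain ⟨t, hyz⟩ := ht y z
  have h := (rep_maps_mul σ _ _ _ _).2 ⟨y, hy, hyz⟩
  rw [R.unit_mul_of_maps (R.rep_maps_of_maps h0 hy hz hyz), ← R.unit_mul_of_maps hs] at h
  exact rep_maps_of_natLE σ (idem_mul_le (R.unit_mul_unit p p p) s) h

/-- Any faithful transitive representation is equivalent to `R.rep`. -/
theorem equivalentRep [Nonempty P] (hf : IsFaithfulRep σ) (ht : IsTransitiveRep σ) :
    EquivalentRep σ R.rep := by
  have h0 := R.not_maps_zero_of_faithful hf ht
  choose θ hθ using R.exists_unit_maps h0 hf ht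
  have hbij : Function.Bijective θ := by
    constructor
    · intro y z hyz
      have hz := hθ z
      rw [← hyz] at hz
      -- With a common label $p$, the idempotent $e_{pp}$ carries $y$ to $z$, so the two coincide.
      exact eq_of_rep_idem_maps σ (R.unit_mul_unit (θ y) (θ y) (θ y))
        (R.maps_of_rep_maps h0 ht (hθ y) hz (R.maps_unit_self _ _))
    · intro p
      obtain ⟨y, hy⟩ := R.exists_maps_unit h0 hf p
      refine ⟨y, ?_⟩
      -- The point $y$ has both labels $\theta(y)$ and $p$. Since $e_{pp}$ fixes $y$, it sends
      -- $\theta(y)$ to $p$, so the labels agree.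
      exact ((R.maps_unit _ _ _ _).1 (R.rep_maps_of_maps h0 (hθ y) hy hy)).1
  exact ⟨Equiv.ofBijective θ hbij, fun s y z =>
    ⟨R.rep_maps_of_maps h0 (hθ y) (hθ z), R.maps_of_rep_maps h0 ht (hθ y) (hθ z)⟩⟩

end Uniqueness

/-! ### Cosets of point stabilisers -/

/-- As for permutation groups, a coset of the stabiliser of $p$ records the image $q$ of $p$. If $x$
and $t$ both send $p$ to $q$, then $e_{pp}x=e_{pq}=e_{pp}t\le t$. -/
theorem mem_cosetSet_above {p q : P} {x t : S} (hp : R.unit p p * R.unit p p = R.unit p p)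
    (hx : (R.rep x).Maps p q) :
    t ∈ (ClosedInvSubsemigroup.above (R.unit p p) hp).cosetSet x ↔ (R.rep t).Maps p q := by
  constructor
  · rintro ⟨h, hh, hle⟩
    exact rep_maps_of_natLE R.rep hle ((rep_maps_mul _ _ _ _ _).2 ⟨p, R.unit_natLE_iff.1 hh, hx⟩)
  · intro ht
    refine ⟨R.unit p p, InverseSemigroup.le_refl _, ?_⟩
    rw [R.unit_mul_of_maps hx, ← R.unit_mul_of_maps ht]
    exact idem_mul_le hp t

/-- The coset of $e_{pq}$ stands for the point $q$, so the action of $s$ on cosets determines its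
action on $P$. -/
theorem faithful_cosetRep_above (p : P) (hp : R.unit p p * R.unit p p = R.unit p p) :
    IsFaithfulRep (ClosedInvSubsemigroup.above (R.unit p p) hp).cosetRep := by
  set H := ClosedInvSubsemigroup.above (R.unit p p) hp
  have hmem : ∀ q, R.unit p q * (R.unit p q)⁻¹ ∈ H.carrier := fun q =>
    R.unit_natLE_iff.2 ((rep_maps_mul _ _ _ _ _).2
      ⟨q, R.maps_unit_self p q, rep_maps_inv R.rep (R.maps_unit_self p q)⟩)
  have key : ∀ s t, H.cosetRep s = H.cosetRep t → ∀ q r, (R.rep s).Maps q r →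
      (R.rep t).Maps q r := by
    intro s t hst q r hqr
    have h1 : (H.cosetRep s).Maps ⟨_, R.unit p q, hmem q, rfl⟩ ⟨_, R.unit p r, hmem r, rfl⟩ :=
      (H.cosetRep_maps _ _ _).2 ⟨_, rfl, by rw [R.unit_mul_of_maps hqr]⟩
    rw [hst] at h1
    obtain ⟨x, hx, hxt⟩ := (H.cosetRep_maps _ _ _).1 h1
    change H.cosetSet (R.unit p q) = _ at hx
    change H.cosetSet (R.unit p r) = _ at hxt
    -- The representative $x$ sends $p$ to $q$ and $xt$ sends $p$ to $r$; therefore $t$ sends $q$ to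
    -- $r$.
    have h2 := H.self_mem_cosetSet x
    rw [← hx, R.mem_cosetSet_above hp (R.maps_unit_self p q)] at h2
    have h3 := H.self_mem_cosetSet (x * t)
    rw [← hxt, R.mem_cosetSet_above hp (R.maps_unit_self p r)] at h3
    obtain ⟨w, hw, hwr⟩ := (rep_maps_mul _ _ _ _ _).1 h3
    rwa [h2.right_unique hw]
  exact fun s t hst => R.ext_maps fun q r => ⟨key s t hst q r, key t s hst.symm q r⟩

/-- An equivalence preserves stabilisers: $H$ stabilises one of its cosets, hence is the stabiliser
of the corresponding point of $P$. -/
theorem exists_eq_above [Nonempty P] (H : ClosedInvSubsemigroup S)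
    (hf : IsFaithfulRep H.cosetRep) :
    ∃ p, H = ClosedInvSubsemigroup.above (R.unit p p) (R.unit_mul_unit p p p) := by
  obtain ⟨θ, hθ⟩ := R.equivalentRep hf H.cosetRep_transitive
  obtain ⟨A, hA⟩ := H.exists_coset_stabilizer
  refine ⟨θ A, ClosedInvSubsemigroup.ext (Set.ext fun s => ?_)⟩
  rw [← hA, hθ]
  exact R.unit_natLE_iff.symm

/-- The element $e_{pq}$ carries $p$ to $q$, so it conjugates the stabilisers of these points into
each other. -/
theorem conjugate_above (p q : P) :
    (ClosedInvSubsemigroup.above (R.unit p p) (R.unit_mul_unit p p p)).Conjugate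
      (ClosedInvSubsemigroup.above (R.unit q q) (R.unit_mul_unit q q q)) := by
  have h1 := R.maps_unit_self p q
  have h2 := rep_maps_inv R.rep h1
  refine ⟨R.unit p q, fun h hh => R.unit_natLE_iff.2 ?_, fun k hk => R.unit_natLE_iff.2 ?_⟩
  · exact (rep_maps_mul _ _ _ _ _).2
      ⟨p, (rep_maps_mul _ _ _ _ _).2 ⟨p, h2, R.unit_natLE_iff.1 hh⟩, h1⟩
  · exact (rep_maps_mul _ _ _ _ _).2
      ⟨q, (rep_maps_mul _ _ _ _ _).2 ⟨q, h1, R.unit_natLE_iff.1 hk⟩, h2⟩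

theorem classification [Nonempty P] :
    (∃ e : S, IsPrimitiveIdem e) ∧
    (∀ (e : S) (he : IsPrimitiveIdem e),
      EquivalentRep (ClosedInvSubsemigroup.above e he.1).cosetRep R.rep) ∧
    (∀ H : ClosedInvSubsemigroup S, IsFaithfulRep H.cosetRep ↔
      ∃ (e : S) (he : IsPrimitiveIdem e), H = ClosedInvSubsemigroup.above e he.1) ∧
    (∀ H K : ClosedInvSubsemigroup S,
      IsFaithfulRep H.cosetRep → IsFaithfulRep K.cosetRep → H.Conjugate K) := by
  have hprim : ∀ p, IsPrimitiveIdem (R.unit p p) := fun p => R.isPrimitiveIdem_iff.2 ⟨p, rfl⟩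
  refine ⟨⟨_, hprim (Classical.arbitrary P)⟩, ?_, ?_, ?_⟩
  · intro e he
    obtain ⟨p, rfl⟩ := R.isPrimitiveIdem_iff.1 he
    exact R.equivalentRep (R.faithful_cosetRep_above p he.1)
      (ClosedInvSubsemigroup.cosetRep_transitive _)
  · intro H
    constructor
    · intro hf
      obtain ⟨p, hp⟩ := R.exists_eq_above H hf
      exact ⟨_, hprim p, hp⟩
    · rintro ⟨e, he, rfl⟩
      obtain ⟨p, rfl⟩ := R.isPrimitiveIdem_iff.1 he
      exact R.faithful_cosetRep_above p he.1
  · intro H K hH hK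
    obtain ⟨p, rfl⟩ := R.exists_eq_above H hH
    obtain ⟨q, rfl⟩ := R.exists_eq_above K hK
    exact R.conjugate_above p q

end RankOneRep

/-! ### Partitions with at most one generalised line -/

namespace PICarrier

variable {X : Type*}

/-- The partition all of whose blocks are points. -/
def points (X : Type*) : PICarrier X where
  part := ⊥
  pt_or_line _ := Or.inl fun _ h => Eq.symm h

/-- The partition with the single generalised line `A ∪ B'`. -/
def single (A B : Set X) (hA : A.Nonempty) (hB : B.Nonempty) : PICarrier X where
  part :=
    { r := fun u v => u = v ∨ (pair A B u ∧ pair A B v)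
      iseqv := by
        refine ⟨fun u => Or.inl rfl, ?_, ?_⟩
        · rintro u v (rfl | ⟨h1, h2⟩)
          · exact Or.inl rfl
          · exact Or.inr ⟨h2, h1⟩
        · rintro u v w (rfl | ⟨h1, h2⟩) (rfl | ⟨h1', h2'⟩)
          · exact Or.inl rfl
          · exact Or.inr ⟨h1', h2'⟩
          · exact Or.inr ⟨h1, h2⟩
          · exact Or.inr ⟨h1, h2'⟩ }
  pt_or_line u := by
    by_cases hu : pair A B u
    · obtain ⟨i, hi⟩ := hA
      obtain ⟨j, hj⟩ := hB
      exact Or.inr ⟨⟨i, Or.inr ⟨hu, hi⟩⟩, j, Or.inr ⟨hu, hj⟩⟩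
    · left
      rintro v (h | ⟨h, -⟩)
      · exact h.symm
      · exact absurd h hu

theorem isLine_single_self {A B : Set X} (hA : A.Nonempty) (hB : B.Nonempty) :
    (single A B hA hB).IsLine A B := by
  obtain ⟨i, hi⟩ := id hA
  refine ⟨hA, hB, Sum.inl i, fun v => ⟨fun hv => Or.inr ⟨hi, hv⟩, ?_⟩⟩
  rintro (rfl | ⟨-, h⟩)
  · exact hi
  · exact h

theorem pair_of_isGenLine_single {A B : Set X} {hA : A.Nonempty} {hB : B.Nonempty} {u : X ⊕ X}
    (h : IsGenLine (single A B hA hB).part u) : pair A B u := by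
  obtain ⟨⟨i, hi⟩, j, hj⟩ := h
  rcases hi with rfl | ⟨h, -⟩
  · rcases hj with hj | ⟨h, -⟩
    · cases hj
    · exact h
  · exact h

theorem isLine_single {A B : Set X} (hA : A.Nonempty) (hB : B.Nonempty) (C D : Set X) :
    (single A B hA hB).IsLine C D ↔ C = A ∧ D = B := by
  constructor
  · intro h
    obtain ⟨i, hi⟩ := h.1
    have hi' : pair C D (Sum.inl i) := hi
    exact isLine_eq_of_mem h (isLine_single_self hA hB) hi'
      (pair_of_isGenLine_single (isGenLine_of_isLine h hi'))
  · rintro ⟨rfl, rfl⟩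
    exact isLine_single_self hA hB

/-- A generalised line meets both rows. Hence in the action on all subsets by unions of lines the
empty set is an orbit by itself, fixed by every element; removing it loses no information and leaves
$2^n-1$ points. -/
theorem nonempty_right_of_isLines {α : PICarrier X} {A B : Set X} (h : α.IsLines A B)
    (hA : A.Nonempty) : B.Nonempty := by
  obtain ⟨i, hi⟩ := hA
  obtain ⟨-, j, hj⟩ := h.2 (Sum.inl i) hi
  exact ⟨j, h.1 _ (Sum.inr j) hj hi⟩

theorem nonempty_left_of_isLines {α : PICarrier X} {A B : Set X} (h : α.IsLines A B)
    (hB : B.Nonempty) : A.Nonempty :=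
  nonempty_right_of_isLines ((isLines_flip α B A).2 h) hB

theorem isLines_empty (α : PICarrier X) : α.IsLines ∅ ∅ := by
  have h : ∀ u : X ⊕ X, ¬ pair ∅ ∅ u := by rintro (u | u) hu <;> exact hu
  exact ⟨fun u _ _ hu => absurd hu (h u), fun u hu => absurd hu (h u)⟩

/-- The empty union of lines is excluded by taking $C$ nonempty; only the full line remains. -/
theorem isLines_single {A B : Set X} (hA : A.Nonempty) (hB : B.Nonempty) {C D : Set X}
    (hC : C.Nonempty) : (single A B hA hB).IsLines C D ↔ C = A ∧ D = B := by
  constructor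
  · intro h
    obtain ⟨i, hi⟩ := hC
    have hi' := pair_of_isGenLine_single (h.2 (Sum.inl i) hi)
    have : ∀ v, pair C D v ↔ pair A B v := fun v =>
      ⟨fun hv => pair_of_isGenLine_single (h.2 v hv),
        fun hv => h.1 (Sum.inl i) v (Or.inr ⟨hi', hv⟩) hi⟩
    exact ⟨Set.ext fun i => this (Sum.inl i), Set.ext fun j => this (Sum.inr j)⟩
  · rintro ⟨rfl, rfl⟩
    exact isLines_of_isLine (isLine_single_self hA hB)

theorem not_isGenLine_points (u : X ⊕ X) : ¬ IsGenLine (points X).part u := by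
  rintro ⟨⟨i, hi⟩, j, hj⟩
  obtain rfl : u = _ := hi
  have : Sum.inl i = Sum.inr j := hj
  cases this

end PICarrier

/-! ### The two actions on nonempty subsets and the theorem -/

open PICarrier

/-- The action of `PIStar X` on nonempty unions of upper parts of generalised lines. -/
noncomputable def PIStar.rankOneRep {X P : Type*} (ε : P ≃ {A : Set X // A.Nonempty}) :
    RankOneRep (PIStar X) P :=
  RankOneRep.ofRel (fun a p q => PICarrier.IsLines a (ε p).1 (ε q).1)
    (by
      intro a b hab
      have key : ∀ A B : Set X, A.Nonempty → B.Nonempty →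
          (PICarrier.IsLines a A B ↔ PICarrier.IsLines b A B) := by
        intro A B hA hB
        have := congrFun (congrFun hab (ε.symm ⟨A, hA⟩)) (ε.symm ⟨B, hB⟩)
        simpa using this
      apply PICarrier.ext_isLines
      intro A B
      -- The relations are known to agree on nonempty sets only; when $A$ or $B$ is empty, both hold
      -- if both sets are empty and neither holds otherwise.
      rcases A.eq_empty_or_nonempty with rfl | hA <;> rcases B.eq_empty_or_nonempty with rfl | hB
      · exact iff_of_true (isLines_empty _) (isLines_empty _)
      · exact iff_of_false
          (fun h => Set.not_nonempty_empty (nonempty_left_of_isLines h hB))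
          (fun h => Set.not_nonempty_empty (nonempty_left_of_isLines h hB))
      · exact iff_of_false
          (fun h => Set.not_nonempty_empty (nonempty_right_of_isLines h hA))
          (fun h => Set.not_nonempty_empty (nonempty_right_of_isLines h hA))
      · exact key A B hA hB)
    (fun _ _ _ _ h h' => ε.injective (Subtype.ext (isLines_unique_right h h')))
    (fun a p q => isLines_flip a _ _)
    (fun a b p r => (isLines_star a b _ _).trans
      -- The intermediate set inherits nonemptiness from the first one, so composition stays inside
      -- the nonempty subsets.
      ⟨fun ⟨B, h1, h2⟩ => ⟨ε.symm ⟨B, nonempty_right_of_isLines h1 (ε p).2⟩,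
        by simpa using h1, by simpa using h2⟩, fun ⟨_, h1, h2⟩ => ⟨_, h1, h2⟩⟩)
    (points X)
    (fun p _ h => (ε p).2.elim fun i hi => not_isGenLine_points _ (h.2 (Sum.inl i) hi))
    (fun p q => single (ε p).1 (ε q).1 (ε p).2 (ε q).2)
    (fun p q x y => (isLines_single _ _ (ε x).2).trans
      (and_congr (Subtype.ext_iff.symm.trans ε.injective.eq_iff)
        (Subtype.ext_iff.symm.trans ε.injective.eq_iff)))

/-- The action of `PIBar X` on upper parts of generalised lines. -/
noncomputable def PIBar.rankOneRep {X P : Type*} (ε : P ≃ {A : Set X // A.Nonempty}) :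
    RankOneRep (PIBar X) P :=
  RankOneRep.ofRel (fun a p q => PICarrier.IsLine a (ε p).1 (ε q).1)
    (by
      intro a b hab
      have key : ∀ A B : Set X, A.Nonempty → B.Nonempty →
          (PICarrier.IsLine a A B ↔ PICarrier.IsLine b A B) := by
        intro A B hA hB
        have := congrFun (congrFun hab (ε.symm ⟨A, hA⟩)) (ε.symm ⟨B, hB⟩)
        simpa using this
      apply PICarrier.ext_isLine
      intro A B
      exact ⟨fun h => (key A B h.1 h.2.1).1 h, fun h => (key A B h.1 h.2.1).2 h⟩)
    (fun _ _ _ _ h h' => ε.injective (Subtype.ext (isLine_unique_right h h')))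
    (fun a p q => isLine_flip a _ _)
    (fun a b p r => (isLine_circ a b _ _).trans
      ⟨fun ⟨B, h1, h2⟩ => ⟨ε.symm ⟨B, h1.2.1⟩, by simpa using h1, by simpa using h2⟩,
        fun ⟨_, h1, h2⟩ => ⟨_, h1, h2⟩⟩)
    (points X)
    (fun p _ h => (ε p).2.elim fun i hi =>
      not_isGenLine_points (Sum.inl i) (isGenLine_of_isLine h hi))
    (fun p q => single (ε p).1 (ε q).1 (ε p).2 (ε q).2)
    (fun p q x y => (isLine_single _ _ _ _).trans
      (and_congr (Subtype.ext_iff.symm.trans ε.injective.eq_iff)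
        (Subtype.ext_iff.symm.trans ε.injective.eq_iff)))

theorem nonempty_equiv_nonempty_sets (n : ℕ) :
    Nonempty (Fin (2 ^ n - 1) ≃ {A : Set (Fin n) // A.Nonempty}) := by
  classical
  refine ⟨(Fintype.equivFinOfCardEq ?_).symm⟩
  have h : Fintype.card {A : Set (Fin n) // A.Nonempty} =
      Fintype.card {A : Set (Fin n) // A ≠ ∅} :=
    Fintype.card_congr (Equiv.subtypeEquivRight fun _ => Set.nonempty_iff_ne_empty)
  rw [h, Fintype.card_subtype_compl, Fintype.card_subtype_eq, Fintype.card_set, Fintype.card_fin]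

theorem mainTheorem4 (n : ℕ) (hn : 2 ≤ n) :
    (∃ ρ : PIStar (Fin n) →ₙ* SymInv (Fin (2 ^ n - 1)),
      IsFaithfulRep ρ ∧ IsEffectiveRep ρ ∧ IsTransitiveRep ρ ∧
      -- `ρ` comes from a primitive idempotent, and it does not matter from which one
      (∃ e : PIStar (Fin n), IsPrimitiveIdem e) ∧
      (∀ (e : PIStar (Fin n)) (he : IsPrimitiveIdem e),
        EquivalentRep (ClosedInvSubsemigroup.above e he.1).cosetRep ρ) ∧
      -- the faithful ones among the representations on cosets
      (∀ H : ClosedInvSubsemigroup (PIStar (Fin n)), IsFaithfulRep H.cosetRep ↔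
        ∃ (e : PIStar (Fin n)) (he : IsPrimitiveIdem e), H = ClosedInvSubsemigroup.above e he.1) ∧
      (∀ H K : ClosedInvSubsemigroup (PIStar (Fin n)),
        IsFaithfulRep H.cosetRep → IsFaithfulRep K.cosetRep → H.Conjugate K) ∧
      -- uniqueness among all representations by partial bijections
      (∀ (Y : Type*) (σ : PIStar (Fin n) →ₙ* SymInv Y),
        IsFaithfulRep σ → IsEffectiveRep σ → IsTransitiveRep σ → EquivalentRep σ ρ)) ∧
    (∃ ρ : PIBar (Fin n) →ₙ* SymInv (Fin (2 ^ n - 1)),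
      IsFaithfulRep ρ ∧ IsEffectiveRep ρ ∧ IsTransitiveRep ρ ∧
      (∃ e : PIBar (Fin n), IsPrimitiveIdem e) ∧
      (∀ (e : PIBar (Fin n)) (he : IsPrimitiveIdem e),
        EquivalentRep (ClosedInvSubsemigroup.above e he.1).cosetRep ρ) ∧
      (∀ H : ClosedInvSubsemigroup (PIBar (Fin n)), IsFaithfulRep H.cosetRep ↔
        ∃ (e : PIBar (Fin n)) (he : IsPrimitiveIdem e), H = ClosedInvSubsemigroup.above e he.1) ∧
      (∀ H K : ClosedInvSubsemigroup (PIBar (Fin n)),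
        IsFaithfulRep H.cosetRep → IsFaithfulRep K.cosetRep → H.Conjugate K) ∧
      (∀ (Y : Type*) (σ : PIBar (Fin n) →ₙ* SymInv Y),
        IsFaithfulRep σ → IsEffectiveRep σ → IsTransitiveRep σ → EquivalentRep σ ρ)) := by
  obtain ⟨ε⟩ := nonempty_equiv_nonempty_sets n
  have hlt : 1 < 2 ^ n := Nat.one_lt_two_pow (by omega)
  have : Nonempty (Fin (2 ^ n - 1)) := ⟨⟨0, by omega⟩⟩
  constructor
  · let R := PIStar.rankOneRep ε
    obtain ⟨h1, h2, h3, h4⟩ := R.classification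
    exact ⟨R.rep, R.faithful, R.rep_effective, R.rep_transitive, h1, h2, h3, h4,
      fun _ _ hf _ ht => R.equivalentRep hf ht⟩
  · let R := PIBar.rankOneRep ε
    obtain ⟨h1, h2, h3, h4⟩ := R.classification
    exact ⟨R.rep, R.faithful, R.rep_effective, R.rep_transitive, h1, h2, h3, h4,
      fun _ _ hf _ ht => R.equivalentRep hf ht⟩
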